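/- Let $S$ be a finite set of points in ${\bf R}^d$. A triangulation $t$ of $S$ is a geometric simplicial complex in ${\bf R}^d$ whose set of vertices is $S$ and whose simplices fill the convex hull $CH(S)$. Let $\Delta_i$ be its $d$-simplices, $x_{i0},\dots,x_{id}$ the vertices of $\Delta_i$ and $c(\Delta_i)=\frac1{d+1}\sum_j x_{ij}$ its barycenter, and put $$C2(t)=\sum_i \|c(\Delta_i)\|^2\,vol(\Delta_i),\qquad V(t)=\sum_i\bigl(\|x_{i0}\|^2+\dots+\|x_{id}\|^2\bigr)\,vol(\Delta_i).$$ (a) For every triangulation $t$ of $S$, $$(d+1)^2\,C2(t)+V(t)=(d+1)(d+2)\int_{CH(S)}\|x\|^2\,dx .$$ (b) For every triangulation $t$ of $S$, $V(t)/(d+1)$ is the $(d+1)$-dimensional volume of the solid body in ${\bf R}^d\times{\bf R}$ between the hyperplane $y=0$ and the polyhedral surface obtained from $t$ by lifting every point $x$ of $S$ to the point $(x,\|x\|^2)$ of the paraboloid and connecting the lifted points by the simplices of $t$. (c) Let $V_p$, the Voronoi cell of $p\in S$, be the set of the points of ${\bf R}^d$ that are at least as close to $p$ as to every other point of $S$.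 Suppose that $S$ is generic: it does not lie in a hyperplane, and no point of ${\bf R}^d$ belongs to more than $d+1$ Voronoi cells (for example, no $d+2$ points of $S$ lie on a common sphere). Then there is exactly one triangulation of $S$ that is the straight-line dual of the Voronoi diagram, i.e. whose simplices are spanned by exactly those nonempty sets $T\subseteq S$ with $\bigcap_{p\in T}V_p\ne\emptyset$; it is called the Delaunay triangulation. The functional $V$ on the triangulations of $S$ achieves its minimum at $t$ if and only if $t$ is the Delaunay triangulation. -/

import Mathlib

open MeasureTheory

noncomputable section

namespace Delaunay

/-- Euclidean space `ℝ^d`. -/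
abbrev Pt (d : ℕ) : Type := EuclideanSpace ℝ (Fin d)

/-- The Voronoi cell of the site `p` of `S`: the points that are at least as close to `p` as to
every other site. -/
def voronoiCell {d : ℕ} (S : Finset (Pt d)) (p : Pt d) : Set (Pt d) :=
  {x | ∀ q ∈ S, q ≠ p → dist x p ≤ dist x q}

/-- The (vertex sets of the) simplices of the straight-line dual of the Voronoi diagram of `S`:
the nonempty sets of sites whose Voronoi cells have a common point. -/
def voronoiDual {d : ℕ} (S : Finset (Pt d)) : Set (Finset (Pt d)) :=
  {s | s.Nonempty ∧ s ⊆ S ∧ (⋂ p ∈ s, voronoiCell S p).Nonempty}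

open Classical in
/-- `S` is generic: it does not lie in a hyperplane, and no point of `ℝ^d` belongs to more than
`d + 1` Voronoi cells. (The second condition holds in particular when no `d + 2` points of `S` lie
on a common sphere.) -/
structure IsGeneric {d : ℕ} (S : Finset (Pt d)) : Prop where
  affineSpan_eq_top : affineSpan ℝ (S : Set (Pt d)) = ⊤
  card_le : ∀ x : Pt d, (S.filter fun p => x ∈ voronoiCell S p).card ≤ d + 1

/-- A triangulation of `S`: a geometric simplicial complex whose set of vertices is `S` and whose
simplices fill the convex hull of `S`. -/
@[ext]
structure Triangulation {d : ℕ} (S : Finset (Pt d)) extends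
    Geometry.SimplicialComplex ℝ (Pt d) where
  vertices_eq : toSimplicialComplex.vertices = (S : Set (Pt d))
  space_eq : toSimplicialComplex.space = convexHull ℝ (S : Set (Pt d))

namespace Triangulation

variable {d : ℕ} {S : Finset (Pt d)}

open Classical in
/-- The `d`-simplices `Δ_i` of a triangulation of a set in `ℝ^d`, given by their vertex sets. -/
def cells (t : Triangulation S) : Finset (Finset (Pt d)) :=
  S.powerset.filter fun s => s ∈ t.faces ∧ s.card = d + 1

theorem mem_cells (t : Triangulation S) (s : Finset (Pt d)) :
    s ∈ t.cells ↔ s ∈ t.faces ∧ s.card = d + 1 := by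
  classical
  simp only [cells, Finset.mem_filter, Finset.mem_powerset, and_iff_right_iff_imp]
  intro h x hx
  have h1 : x ∈ t.vertices :=
    t.down_closed h.1 (Finset.singleton_subset_iff.2 hx) (Finset.singleton_nonempty x)
  rw [t.vertices_eq] at h1
  exact h1

end Triangulation

/-- The volume of the simplex with vertex set `s`. -/
def vol {d : ℕ} (s : Finset (Pt d)) : ℝ :=
  (volume (convexHull ℝ (s : Set (Pt d)))).toReal

/-- The barycenter of the `d`-simplex with vertex set `s`. -/
def barycenter {d : ℕ} (s : Finset (Pt d)) : Pt d :=
  ((d : ℝ) + 1)⁻¹ • ∑ x ∈ s, x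

namespace Triangulation

variable {d : ℕ} {S : Finset (Pt d)}

/-- The functional `C2(t) = ∑_i ‖c(Δ_i)‖² vol(Δ_i)`. -/
def C2 (t : Triangulation S) : ℝ :=
  ∑ s ∈ t.cells, ‖barycenter s‖ ^ 2 * vol s

/-- The functional `V(t) = ∑_i (‖x_{i0}‖² + … + ‖x_{id}‖²) vol(Δ_i)`. -/
def V (t : Triangulation S) : ℝ :=
  ∑ s ∈ t.cells, (∑ x ∈ s, ‖x‖ ^ 2) * vol s

/-- `t` is the Delaunay triangulation: the straight-line dual of the Voronoi diagram. -/
def IsDelaunay (t : Triangulation S) : Prop :=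
  t.faces = voronoiDual S

/-- The polyhedral surface in `ℝ^d × ℝ` that arises from `t` by lifting the vertices to the
paraboloid `y = ‖x‖²` and connecting them by the simplices of `t`. -/
def liftedSurface (t : Triangulation S) : Set (Pt d × ℝ) :=
  ⋃ s ∈ t.faces, convexHull ℝ ((fun x : Pt d => (x, ‖x‖ ^ 2)) '' (s : Set (Pt d)))

/-- The solid body between the hyperplane `y = 0` and the lifted surface. -/
def bodyBelow (t : Triangulation S) : Set (Pt d × ℝ) :=
  {w | 0 ≤ w.2 ∧ ∃ z : ℝ, (w.1, z) ∈ t.liftedSurface ∧ w.2 ≤ z}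

end Triangulation

end Delaunay

end

/-!
Everything rests on the moments of the barycentric coordinates `λ_i` of a `d`-simplex.
Exchanging two vertices shows that all `∫ λ_i²` agree. Bisecting the simplex at the midpoint of the
edge from the vertex `i` to the vertex `j` gives two halves, interchanged by that exchange, each
the image of the whole simplex under an affine map that turns `λ_j - λ_i`, up to sign, into a single
coordinate; so `∫ (λ_j - λ_i)² = ∫ λ_j²`, that is, `∫ λ_i λ_j = ½ ∫ λ_i²`. Together with
`∑ λ_i = 1` this determines all second moments (`setIntegral_coord_mul_coord`), hence the integrals
of affine functions (`setIntegral_affineMap`) and of `‖x‖²` (`setIntegral_norm_sq`). The simplices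
of lower dimension are null sets and the `d`-simplices overlap in null sets, so summation over the
cells gives the identity for `C2` and `V` and the volume of the body below the lifted surface.

For the Delaunay triangulation, each center `c` has an affine function that lies below the
paraboloid at all sites and touches it exactly at the sites nearest to `c`
(`exists_supporting_affineMap`).
* The nearest sites are affinely independent: from a dependent set, `c` could be moved orthogonally
  to the span to gain further nearest sites without end (`affineIndependent_nearestSites`).
* Two simplices of the dual meet in a common face by complementary slackness
  (`convexHull_inter_subset_of_subset_nearestSites`).
* The dual covers the convex hull: at an interior point `x`, the height at `x` of the highest affine
  function of given slope below the lifted sites attains its maximum over all slopes, and at the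
  maximum `x` lies in the convex hull of the nearest sites
  (`exists_mem_convexHull_nearestSites_of_mem_interior`). The boundary follows by taking closures.

The lifted Delaunay triangulation therefore lies below every other lifted triangulation, so its body
has the smallest volume, which is `V / (d + 1)`. If `V` is the same for a triangulation `t`, then
the two bodies differ by a null set. A strict inequality of the heights at the barycenter of a cell
of `t` would leave a nonempty open set between them. So the heights agree there, and complementary
slackness makes the cell a Delaunay simplex. Every simplex of `t` is a face of a cell, hence `t` is
contained in the Delaunay triangulation, and equal to it because both cover the convex hull.
-/

noncomputable section

set_option linter.unusedSectionVars false

namespace Delaunay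

/-! ### Moments of the barycentric coordinates over a simplex -/

section Moments

variable {E : Type*} [NormedAddCommGroup E] [NormedSpace ℝ E] [FiniteDimensional ℝ E]
  [MeasurableSpace E] [BorelSpace E] (μ : Measure E) [μ.IsAddHaarMeasure]

/-- The maps `x ↦ x + f x • v` with `f` affine are affine, so an injective one of them scales all
integrals by one and the same factor. -/
theorem exists_setIntegral_image_shear (f : E →ᵃ[ℝ] ℝ) (v : E)
    (hinj : Function.Injective fun x => x + f x • v) :
    ∃ c : ℝ, ∀ s, MeasurableSet s → ∀ g : E → ℝ,
      ∫ x in (fun x => x + f x • v) '' s, g x ∂μ = c * ∫ x in s, g (x + f x • v) ∂μ := by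
  have hf : ∀ x, HasFDerivAt f (LinearMap.toContinuousLinearMap f.linear) x := by
    intro x
    have h := ((LinearMap.toContinuousLinearMap f.linear).hasFDerivAt (x := x)).add_const (f 0)
    refine h.congr_of_eventuallyEq (Filter.Eventually.of_forall fun y => ?_)
    have := congrFun (AffineMap.decomp f) y
    simpa using this
  let A : E →L[ℝ] E :=
    ContinuousLinearMap.id ℝ E + (LinearMap.toContinuousLinearMap f.linear).smulRight v
  have hA : ∀ x, HasFDerivAt (fun x => x + f x • v) A x := fun x =>
    (hasFDerivAt_id x).add ((hf x).smul_const v)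
  refine ⟨|A.det|, fun s hs g => ?_⟩
  rw [integral_image_eq_integral_abs_det_fderiv_smul μ hs
    (fun x _ => (hA x).hasFDerivWithinAt) hinj.injOn g]
  simp only [smul_eq_mul]
  rw [integral_const_mul]

variable {ι : Type*} [Fintype ι] [DecidableEq ι] (b : AffineBasis ι ℝ E)

theorem coord_add_smul_sub (i j k : ι) (x : E) (r : ℝ) :
    b.coord k (x + r • (b j - b i)) =
      b.coord k x + r * ((if k = j then 1 else 0) - if k = i then 1 else 0) := by
  have h1 : x + r • (b j - b i) = (r • (b j -ᵥ b i)) +ᵥ x := by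
    rw [vadd_eq_add, vsub_eq_sub, add_comm]
  rw [h1, AffineMap.map_vadd, map_smul, AffineMap.linearMap_vsub, b.coord_apply, b.coord_apply]
  simp only [vsub_eq_sub, smul_eq_mul, vadd_eq_add]
  ring

theorem mem_convexHull_range_iff (x : E) :
    x ∈ convexHull ℝ (Set.range b) ↔ ∀ i, 0 ≤ b.coord i x := by
  rw [b.convexHull_eq_nonneg_coord]; rfl

theorem isCompact_convexHull_range : IsCompact (convexHull ℝ (Set.range b)) :=
  (Set.finite_range b).isCompact_convexHull ℝ

theorem measureReal_convexHull_range_pos : 0 < μ.real (convexHull ℝ (Set.range b)) := by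
  have h1 : (interior (convexHull ℝ (Set.range b))).Nonempty :=
    interior_convexHull_nonempty_iff_affineSpan_eq_top.2 b.tot
  have h2 : 0 < μ (convexHull ℝ (Set.range b)) :=
    (isOpen_interior.measure_pos μ h1).trans_le (measure_mono interior_subset)
  exact ENNReal.toReal_pos h2.ne' (isCompact_convexHull_range b).measure_lt_top.ne

theorem integrableOn_convexHull_range {g : E → ℝ} (hg : Continuous g) :
    IntegrableOn g (convexHull ℝ (Set.range b)) μ :=
  hg.continuousOn.integrableOn_compact (isCompact_convexHull_range b)

/-- The affine involution that exchanges the vertices `b i` and `b j` of a simplex and fixes the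
other ones. -/
def swapVertices (i j : ι) (x : E) : E := x + (b.coord i - b.coord j) x • (b j - b i)

theorem coord_swapVertices {i j : ι} (k : ι) (x : E) :
    b.coord k (swapVertices b i j x) = b.coord (Equiv.swap i j k) x := by
  rw [swapVertices, coord_add_smul_sub, AffineMap.coe_sub, Pi.sub_apply]
  by_cases hi : k = i
  · subst hi
    by_cases hj : k = j
    · subst hj; simp
    · rw [Equiv.swap_apply_left]; simp [hj]
  · by_cases hj : k = j
    · subst hj; rw [Equiv.swap_apply_right]; simp [hi]
    · rw [Equiv.swap_apply_of_ne_of_ne hi hj]; simp [hi, hj]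

theorem swapVertices_involutive (i j : ι) : Function.Involutive (swapVertices b i j) := by
  intro x
  refine b.ext_elem fun k => ?_
  rw [coord_swapVertices, coord_swapVertices, Equiv.swap_apply_self]

theorem swapVertices_image_convexHull (i j : ι) :
    swapVertices b i j '' convexHull ℝ (Set.range b) = convexHull ℝ (Set.range b) := by
  have h : ∀ x ∈ convexHull ℝ (Set.range b), swapVertices b i j x ∈ convexHull ℝ (Set.range b) := by
    intro x hx
    rw [mem_convexHull_range_iff] at hx ⊢
    intro k
    rw [coord_swapVertices]
    exact hx _
  refine Set.Subset.antisymm (Set.image_subset_iff.2 h) fun x hx => ?_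
  exact ⟨_, h x hx, swapVertices_involutive b i j x⟩

/-- The exchange of two vertices preserves the measure, because it maps the simplex to itself. -/
theorem setIntegral_swapVertices (i j : ι) {s : Set E} (hs : MeasurableSet s) (g : E → ℝ) :
    ∫ x in swapVertices b i j '' s, g x ∂μ = ∫ x in s, g (swapVertices b i j x) ∂μ := by
  obtain ⟨c, hc⟩ := exists_setIntegral_image_shear μ (b.coord i - b.coord j) (b j - b i)
    (swapVertices_involutive b i j).injective
  set K := convexHull ℝ (Set.range b)
  have hK : swapVertices b i j '' K = K := swapVertices_image_convexHull b i j
  -- The simplex itself is preserved, so the factor is `1`.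
  have h1 := hc K (isCompact_convexHull_range b).measurableSet fun _ => 1
  change ∫ x in swapVertices b i j '' K, (1 : ℝ) ∂μ = _ at h1
  rw [hK] at h1
  have hpos : 0 < μ.real K := measureReal_convexHull_range_pos μ b
  simp only [setIntegral_const, smul_eq_mul, mul_one] at h1
  have hc1 : c = 1 := by
    have : (c - 1) * μ.real K = 0 := by linarith
    rcases mul_eq_zero.1 this with h | h
    · linarith
    · exact absurd h hpos.ne'
  have := hc s hs g
  rw [hc1, one_mul] at this
  exact this

theorem setIntegral_coord_sq_eq (i j : ι) :
    ∫ x in convexHull ℝ (Set.range b), b.coord i x ^ 2 ∂μ =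
      ∫ x in convexHull ℝ (Set.range b), b.coord j x ^ 2 ∂μ := by
  have h := setIntegral_swapVertices μ b i j (isCompact_convexHull_range b).measurableSet
    fun x => b.coord i x ^ 2
  rw [swapVertices_image_convexHull] at h
  simpa only [coord_swapVertices, Equiv.swap_apply_left] using h

/-- The half of the simplex on the side of `b j`, when it is bisected at the midpoint of the edge
from `b i` to `b j`. -/
def halfSimplex (i j : ι) : Set E :=
  convexHull ℝ (Set.range b) ∩ {x | b.coord i x ≤ b.coord j x}

theorem measurableSet_halfSimplex (i j : ι) : MeasurableSet (halfSimplex b i j) :=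
  (isCompact_convexHull_range b).measurableSet.inter
    (measurableSet_le (continuous_barycentric_coord b i).measurable
      (continuous_barycentric_coord b j).measurable)

theorem swapVertices_image_halfSimplex (i j : ι) :
    swapVertices b i j '' halfSimplex b i j = halfSimplex b j i := by
  have h : ∀ k l : ι, ∀ x ∈ halfSimplex b k l,
      (∀ m, 0 ≤ b.coord m (swapVertices b i j x)) := by
    intro k l x hx m
    rw [coord_swapVertices]
    exact (mem_convexHull_range_iff b x).1 hx.1 _
  refine Set.Subset.antisymm (Set.image_subset_iff.2 fun x hx => ⟨?_, ?_⟩) fun x hx =>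
    ⟨swapVertices b i j x, ⟨?_, ?_⟩, swapVertices_involutive b i j x⟩
  · exact (mem_convexHull_range_iff b _).2 (h i j x hx)
  · simpa [coord_swapVertices] using hx.2
  · exact (mem_convexHull_range_iff b _).2 (h j i x hx)
  · simpa [coord_swapVertices] using hx.2

theorem aedisjoint_halfSimplex {i j : ι} (hij : i ≠ j) :
    AEDisjoint μ (halfSimplex b i j) (halfSimplex b j i) := by
  let A : AffineSubspace ℝ E := (AffineSubspace.mk' (0 : ℝ) ⊥).comap (b.coord i - b.coord j)
  have hA : ∀ x, x ∈ A ↔ b.coord i x = b.coord j x := by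
    intro x
    simp [A, AffineSubspace.mem_comap, AffineSubspace.mem_mk', sub_eq_zero]
  have hne : A ≠ ⊤ := by
    intro h
    have h1 : b i ∈ A := h ▸ AffineSubspace.mem_top ℝ E (b i)
    rw [hA, b.coord_apply_eq, b.coord_apply_ne hij.symm] at h1
    exact one_ne_zero h1
  refine measure_mono_null ?_ (Measure.addHaar_affineSubspace μ A hne)
  intro x hx
  exact (hA x).2 (le_antisymm hx.1.2 hx.2.2)

theorem halfSimplex_union (i j : ι) :
    halfSimplex b i j ∪ halfSimplex b j i = convexHull ℝ (Set.range b) := by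
  rw [halfSimplex, halfSimplex, ← Set.inter_union_distrib_left]
  refine Set.inter_eq_left.2 fun x _ => ?_
  exact le_total (b.coord i x) (b.coord j x)

/-- A function that is symmetric in two vertices has its integral split evenly by the bisection. -/
theorem setIntegral_eq_two_mul_halfSimplex {i j : ι} (hij : i ≠ j) {g : E → ℝ}
    (hg : Continuous g) (hsymm : ∀ x, g (swapVertices b i j x) = g x) :
    ∫ x in convexHull ℝ (Set.range b), g x ∂μ = 2 * ∫ x in halfSimplex b i j, g x ∂μ := by
  have hint := integrableOn_convexHull_range μ b hg
  rw [← halfSimplex_union b i j, setIntegral_union₀ (aedisjoint_halfSimplex μ b hij)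
    (measurableSet_halfSimplex b j i).nullMeasurableSet
    (hint.mono_set Set.inter_subset_left) (hint.mono_set Set.inter_subset_left),
    ← swapVertices_image_halfSimplex b i j, setIntegral_swapVertices μ b i j
      (measurableSet_halfSimplex b i j)]
  simp only [hsymm]
  ring

/-- The affine map that sends `b i` to the midpoint of `b i` and `b j` and fixes the other vertices;
it maps the simplex onto its half at `b j`. -/
def bisect (i j : ι) (x : E) : E := x + ((2⁻¹ : ℝ) • b.coord i) x • (b j - b i)

theorem coord_bisect {i j : ι} (k : ι) (x : E) :
    b.coord k (bisect b i j x) =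
      b.coord k x + b.coord i x / 2 * ((if k = j then 1 else 0) - if k = i then 1 else 0) := by
  rw [bisect, coord_add_smul_sub]
  simp only [AffineMap.coe_smul, Pi.smul_apply, smul_eq_mul]
  ring

theorem bisect_injective {i j : ι} (hij : i ≠ j) : Function.Injective (bisect b i j) := by
  intro x y h
  have hk := fun k => congrArg (b.coord k) h
  simp only [coord_bisect] at hk
  have hi := hk i
  simp only [hij, if_false, if_true] at hi
  have hi' : b.coord i x = b.coord i y := by linarith
  refine b.ext_elem fun k => ?_
  have := hk k
  rw [hi'] at this
  linarith

theorem bisect_image_convexHull {i j : ι} (hij : i ≠ j) :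
    bisect b i j '' convexHull ℝ (Set.range b) = halfSimplex b i j := by
  refine Set.Subset.antisymm (Set.image_subset_iff.2 fun x hx => ?_) fun x hx => ?_
  · rw [mem_convexHull_range_iff] at hx
    refine ⟨(mem_convexHull_range_iff b _).2 fun k => ?_, ?_⟩
    · rw [coord_bisect]
      have h1 := hx k
      have h2 := hx i
      by_cases hki : k = i
      · subst hki
        simp only [hij, if_false, if_true]
        linarith
      · by_cases hkj : k = j
        · simp only [hkj, hij.symm, if_false, if_true]
          have := hx j
          linarith
        · simp only [hki, hkj, if_false]
          linarith
    · change b.coord i _ ≤ b.coord j _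
      rw [coord_bisect, coord_bisect]
      simp only [hij, hij.symm, if_false, if_true]
      have := hx j
      linarith
  · have h0 := (mem_convexHull_range_iff b _).1 hx.1
    have h1 : b.coord i x ≤ b.coord j x := hx.2
    refine ⟨x + b.coord i x • (b i - b j), (mem_convexHull_range_iff b _).2 fun k => ?_, ?_⟩
    · rw [coord_add_smul_sub]
      have h2 := h0 k
      have h3 := h0 i
      by_cases hki : k = i
      · subst hki
        simp only [hij, if_false, if_true]
        linarith
      · by_cases hkj : k = j
        · subst hkj
          simp only [hij.symm, if_false, if_true]
          linarith
        · simp only [hki, hkj, if_false]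
          linarith
    · rw [bisect, AffineMap.coe_smul, Pi.smul_apply, coord_add_smul_sub]
      simp only [hij, if_false, if_true, smul_eq_mul]
      rw [show (2⁻¹ : ℝ) * (b.coord i x + b.coord i x * (1 - 0)) = b.coord i x by ring, add_assoc,
        ← smul_add, show b i - b j + (b j - b i) = 0 by abel, smul_zero, add_zero]

/-- Bisecting the edge from `b i` to `b j` shows that `λ_j - λ_i` has the same second moment as
`λ_j`, which expresses the mixed moment by the pure one. -/
theorem setIntegral_coord_mul_coord_of_ne {i j : ι} (hij : i ≠ j) :
    ∫ x in convexHull ℝ (Set.range b), b.coord i x * b.coord j x ∂μ =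
      (∫ x in convexHull ℝ (Set.range b), b.coord i x ^ 2 ∂μ) / 2 := by
  have hci := continuous_barycentric_coord b i
  have hcj := continuous_barycentric_coord b j
  have hm := (isCompact_convexHull_range b).measurableSet
  obtain ⟨c, hc⟩ := exists_setIntegral_image_shear μ ((2⁻¹ : ℝ) • b.coord i) (b j - b i)
    (bisect_injective b hij)
  replace hc : ∀ s, MeasurableSet s → ∀ g : E → ℝ, ∫ x in bisect b i j '' s, g x ∂μ =
    c * ∫ x in s, g (bisect b i j x) ∂μ := hc
  have hhalf := fun g => hc _ hm g
  simp only [bisect_image_convexHull b hij] at hhalf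
  have hpos := measureReal_convexHull_range_pos μ b
  have hc2 : 2 * c = 1 := by
    have h1 := setIntegral_eq_two_mul_halfSimplex μ b hij (g := fun _ => 1) continuous_const
      fun _ => rfl
    rw [hhalf] at h1
    simp only [setIntegral_const, smul_eq_mul, mul_one] at h1
    have : (2 * c - 1) * μ.real (convexHull ℝ (Set.range b)) = 0 := by linarith
    rcases mul_eq_zero.1 this with h | h
    · linarith
    · exact absurd h hpos.ne'
  have h2 := setIntegral_eq_two_mul_halfSimplex μ b hij
    (g := fun x => (b.coord j x - b.coord i x) ^ 2) (by fun_prop) fun x => by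
      rw [coord_swapVertices, coord_swapVertices, Equiv.swap_apply_left, Equiv.swap_apply_right]
      ring
  rw [hhalf, ← mul_assoc, hc2, one_mul] at h2
  have h3 : ∀ x, (b.coord j (bisect b i j x) - b.coord i (bisect b i j x)) ^ 2 =
      b.coord j x ^ 2 := by
    intro x
    rw [coord_bisect, coord_bisect]
    simp only [hij, hij.symm, if_false, if_true]
    ring
  simp only [h3] at h2
  have h4 : ∀ x, (b.coord j x - b.coord i x) ^ 2 =
      b.coord j x ^ 2 + b.coord i x ^ 2 - 2 * (b.coord i x * b.coord j x) := fun x => by ring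
  simp only [h4] at h2
  have i1 : IntegrableOn (fun x => b.coord j x ^ 2) (convexHull ℝ (Set.range b)) μ :=
    integrableOn_convexHull_range μ b (by fun_prop)
  have i2 : IntegrableOn (fun x => b.coord i x ^ 2) (convexHull ℝ (Set.range b)) μ :=
    integrableOn_convexHull_range μ b (by fun_prop)
  have i3 : IntegrableOn (fun x => 2 * (b.coord i x * b.coord j x))
      (convexHull ℝ (Set.range b)) μ :=
    integrableOn_convexHull_range μ b (by fun_prop)
  have h5 := integral_sub (i1.add i2) i3
  simp only [Pi.add_apply] at h5
  rw [h5, integral_add i1 i2, integral_const_mul] at h2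
  linarith

theorem setIntegral_coord_eq_mul_sq (i : ι) :
    ∫ x in convexHull ℝ (Set.range b), b.coord i x ∂μ =
      ((Fintype.card ι : ℝ) + 1) / 2 *
        ∫ x in convexHull ℝ (Set.range b), b.coord i x ^ 2 ∂μ := by
  have h1 : ∀ x, b.coord i x = ∑ j, b.coord i x * b.coord j x := fun x => by
    rw [← Finset.mul_sum, b.sum_coord_apply_eq_one, mul_one]
  have hc := continuous_barycentric_coord b
  calc _ = ∫ x in convexHull ℝ (Set.range b), ∑ j, b.coord i x * b.coord j x ∂μ := by
        simp only [← h1]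
    _ = ∑ j, ∫ x in convexHull ℝ (Set.range b), b.coord i x * b.coord j x ∂μ :=
        integral_finsetSum _ fun j _ =>
          integrableOn_convexHull_range μ b (by have := hc i; have := hc j; fun_prop)
    _ = _ := by
        rw [← Finset.add_sum_erase _ _ (Finset.mem_univ i), Finset.sum_congr rfl fun j hj =>
          setIntegral_coord_mul_coord_of_ne μ b (Finset.ne_of_mem_erase hj).symm]
        rw [Finset.sum_const, Finset.card_erase_of_mem (Finset.mem_univ i), Finset.card_univ,
          nsmul_eq_mul, Nat.cast_pred (Fintype.card_pos_iff.2 ⟨i⟩)]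
        simp only [← pow_two]
        ring

theorem setIntegral_coord_sq (i : ι) :
    ∫ x in convexHull ℝ (Set.range b), b.coord i x ^ 2 ∂μ =
      2 * μ.real (convexHull ℝ (Set.range b)) /
        ((Fintype.card ι : ℝ) * ((Fintype.card ι : ℝ) + 1)) := by
  have hc := continuous_barycentric_coord b
  have h1 : μ.real (convexHull ℝ (Set.range b)) =
      ∑ j, ∫ x in convexHull ℝ (Set.range b), b.coord j x ∂μ := by
    rw [← integral_finsetSum _ fun j _ => integrableOn_convexHull_range μ b (hc j)]
    simp only [b.sum_coord_apply_eq_one, setIntegral_const, smul_eq_mul, mul_one]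
  rw [Finset.sum_congr rfl fun j _ => by
    rw [setIntegral_coord_eq_mul_sq, setIntegral_coord_sq_eq μ b j i], Finset.sum_const,
    Finset.card_univ, nsmul_eq_mul] at h1
  have hn : (0 : ℝ) < Fintype.card ι := by exact_mod_cast Fintype.card_pos_iff.2 ⟨i⟩
  rw [h1]
  field_simp

theorem setIntegral_coord (i : ι) :
    ∫ x in convexHull ℝ (Set.range b), b.coord i x ∂μ =
      μ.real (convexHull ℝ (Set.range b)) / Fintype.card ι := by
  have hn : (0 : ℝ) < Fintype.card ι := by exact_mod_cast Fintype.card_pos_iff.2 ⟨i⟩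
  rw [setIntegral_coord_eq_mul_sq, setIntegral_coord_sq]
  field_simp

theorem setIntegral_coord_mul_coord (i j : ι) :
    ∫ x in convexHull ℝ (Set.range b), b.coord i x * b.coord j x ∂μ =
      μ.real (convexHull ℝ (Set.range b)) /
        ((Fintype.card ι : ℝ) * ((Fintype.card ι : ℝ) + 1)) * (1 + if i = j then 1 else 0) := by
  by_cases hij : i = j
  · subst hij
    simp only [← pow_two, setIntegral_coord_sq, if_true]
    ring
  · rw [setIntegral_coord_mul_coord_of_ne μ b hij, setIntegral_coord_sq, if_neg hij]
    ring

/-- The mean of an affine function over a simplex is the mean of its values at the vertices. -/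
theorem setIntegral_affineMap (L : E →ᵃ[ℝ] ℝ) :
    ∫ x in convexHull ℝ (Set.range b), L x ∂μ =
      μ.real (convexHull ℝ (Set.range b)) / Fintype.card ι * ∑ i, L (b i) := by
  have h1 : ∀ x, L x = ∑ i, b.coord i x * L (b i) := by
    intro x
    conv_lhs => rw [← b.affineCombination_coord_eq_self x]
    rw [Finset.map_affineCombination _ _ _ (b.sum_coord_apply_eq_one x),
      Finset.affineCombination_eq_linear_combination _ _ _ (b.sum_coord_apply_eq_one x)]
    rfl
  rw [integral_congr_ae (Filter.Eventually.of_forall h1)]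
  rw [integral_finsetSum _ fun j _ => integrableOn_convexHull_range μ b
    ((continuous_barycentric_coord b j).mul_const _), Finset.mul_sum]
  refine Finset.sum_congr rfl fun i _ => ?_
  rw [integral_mul_const, setIntegral_coord]

end Moments

section InnerMoments

variable {E : Type*} [NormedAddCommGroup E] [InnerProductSpace ℝ E] [FiniteDimensional ℝ E]
  [MeasurableSpace E] [BorelSpace E] (μ : Measure E) [μ.IsAddHaarMeasure]
  {ι : Type*} [Fintype ι] [DecidableEq ι] (b : AffineBasis ι ℝ E)

theorem setIntegral_norm_sq :
    ∫ x in convexHull ℝ (Set.range b), ‖x‖ ^ 2 ∂μ =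
      μ.real (convexHull ℝ (Set.range b)) /
        ((Fintype.card ι : ℝ) * ((Fintype.card ι : ℝ) + 1)) *
          (‖∑ i, b i‖ ^ 2 + ∑ i, ‖b i‖ ^ 2) := by
  have hc := continuous_barycentric_coord b
  have h1 : ∀ x, ‖x‖ ^ 2 = ∑ i, ∑ j, b.coord i x * b.coord j x * inner ℝ (b i) (b j) := by
    intro x
    conv_lhs => rw [← b.linear_combination_coord_eq_self x]
    rw [← real_inner_self_eq_norm_sq, sum_inner]
    refine Finset.sum_congr rfl fun i _ => ?_
    rw [inner_sum]
    refine Finset.sum_congr rfl fun j _ => ?_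
    rw [real_inner_smul_left, real_inner_smul_right]
    ring
  have hint : ∀ i j, IntegrableOn (fun x => b.coord i x * b.coord j x * inner ℝ (b i) (b j))
      (convexHull ℝ (Set.range b)) μ := fun i j =>
    integrableOn_convexHull_range μ b (((hc i).mul (hc j)).mul_const _)
  rw [integral_congr_ae (Filter.Eventually.of_forall h1),
    integral_finsetSum _ fun i _ => integrable_finsetSum _ fun j _ => hint i j]
  simp only [integral_finsetSum _ fun j _ => hint _ j, integral_mul_const,
    setIntegral_coord_mul_coord]
  rw [← real_inner_self_eq_norm_sq (∑ i, b i), sum_inner, ← Finset.sum_add_distrib, Finset.mul_sum]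
  refine Finset.sum_congr rfl fun i _ => ?_
  rw [inner_sum]
  simp only [mul_assoc, ← Finset.mul_sum, add_mul, one_mul, Finset.sum_add_distrib, ite_mul,
    zero_mul, Finset.sum_ite_eq, Finset.mem_univ, if_true]
  congr 2
  simp

end InnerMoments

/-! ### Integrals over a full-dimensional simplex given by its vertex set -/

variable {d : ℕ}

/-- The vertices of a nondegenerate `d`-simplex in `ℝ^d` as an affine basis. -/
def simplexBasis {s : Finset (Pt d)} (hs : AffineIndependent ℝ ((↑) : s → Pt d))
    (hcard : s.card = d + 1) : AffineBasis s ℝ (Pt d) :=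
  ⟨(↑), hs, by
    rw [hs.affineSpan_eq_top_iff_card_eq_finrank_add_one]
    simpa using hcard⟩

theorem range_simplexBasis {s : Finset (Pt d)} (hs : AffineIndependent ℝ ((↑) : s → Pt d))
    (hcard : s.card = d + 1) : Set.range (simplexBasis hs hcard) = (s : Set (Pt d)) :=
  Subtype.range_coe

theorem isCompact_convexHull_coe (s : Finset (Pt d)) :
    IsCompact (convexHull ℝ (s : Set (Pt d))) :=
  s.finite_toSet.isCompact_convexHull ℝ

theorem vol_nonneg (s : Finset (Pt d)) : 0 ≤ vol s := ENNReal.toReal_nonneg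

theorem volume_convexHull_eq_zero {s : Finset (Pt d)}
    (hs : AffineIndependent ℝ ((↑) : s → Pt d)) (hcard : s.card ≠ d + 1) :
    volume (convexHull ℝ (s : Set (Pt d))) = 0 := by
  refine measure_mono_null (convexHull_subset_affineSpan (s : Set (Pt d)))
    (Measure.addHaar_affineSubspace volume _ fun h => hcard ?_)
  have h1 : affineSpan ℝ (Set.range ((↑) : s → Pt d)) = ⊤ := by
    rw [Subtype.range_coe]; exact h
  rw [hs.affineSpan_eq_top_iff_card_eq_finrank_add_one] at h1
  simpa using h1

theorem setIntegral_affineMap_simplex {s : Finset (Pt d)}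
    (hs : AffineIndependent ℝ ((↑) : s → Pt d)) (hcard : s.card = d + 1) (L : Pt d →ᵃ[ℝ] ℝ) :
    ∫ x in convexHull ℝ (s : Set (Pt d)), L x = (∑ p ∈ s, L p) * vol s / ((d : ℝ) + 1) := by
  classical
  have h := setIntegral_affineMap volume (simplexBasis hs hcard) L
  rw [range_simplexBasis] at h
  rw [h, Fintype.card_coe, hcard, ← Finset.sum_coe_sort s]
  simp only [simplexBasis, vol, Measure.real]
  push_cast
  change _ * ∑ i : s, L i = _
  ring

theorem setIntegral_norm_sq_simplex {s : Finset (Pt d)}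
    (hs : AffineIndependent ℝ ((↑) : s → Pt d)) (hcard : s.card = d + 1) :
    ((d : ℝ) + 1) * ((d : ℝ) + 2) * ∫ x in convexHull ℝ (s : Set (Pt d)), ‖x‖ ^ 2 =
      ((d : ℝ) + 1) ^ 2 * (‖barycenter s‖ ^ 2 * vol s) + (∑ x ∈ s, ‖x‖ ^ 2) * vol s := by
  classical
  have h := setIntegral_norm_sq volume (simplexBasis hs hcard)
  rw [range_simplexBasis] at h
  have hd : (d : ℝ) + 1 ≠ 0 := by positivity
  have h2 : ‖barycenter s‖ ^ 2 = (((d : ℝ) + 1)⁻¹) ^ 2 * ‖∑ x ∈ s, x‖ ^ 2 := by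
    rw [barycenter, norm_smul, mul_pow, Real.norm_eq_abs, sq_abs]
  rw [h, Fintype.card_coe, hcard, h2, ← Finset.sum_coe_sort s, ← Finset.sum_coe_sort s]
  simp only [simplexBasis, vol, Measure.real]
  push_cast
  change _ * (_ * (‖∑ i : s, (i : Pt d)‖ ^ 2 + ∑ i : s, ‖(i : Pt d)‖ ^ 2)) = _
  have hd' : (d : ℝ) + 1 + 1 ≠ 0 := by positivity
  field_simp
  ring

/-- Arbitrary values at the vertices of a simplex are interpolated by an affine function. -/
theorem exists_affineMap_eq {s : Finset (Pt d)} (hs : AffineIndependent ℝ ((↑) : s → Pt d))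
    (hcard : s.card = d + 1) (g : Pt d → ℝ) : ∃ L : Pt d →ᵃ[ℝ] ℝ, ∀ p ∈ s, L p = g p := by
  classical
  let b := simplexBasis hs hcard
  refine ⟨(Fintype.linearCombination ℝ fun i : s => g i).toAffineMap.comp b.coords, fun p hp => ?_⟩
  have h : ∀ i : s, b.coord i p = if i = ⟨p, hp⟩ then 1 else 0 := fun i => b.coord_apply i ⟨p, hp⟩
  simp [Fintype.linearCombination_apply, AffineBasis.coords_apply, h]

/-! ### Decomposition of the convex hull into cells -/

namespace Triangulation

variable {S : Finset (Pt d)} (t : Triangulation S)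

theorem subset_of_mem_faces {s : Finset (Pt d)} (hs : s ∈ t.faces) : s ⊆ S := by
  intro x hx
  have h1 : x ∈ t.vertices :=
    t.down_closed hs (Finset.singleton_subset_iff.2 hx) (Finset.singleton_nonempty x)
  rw [t.vertices_eq] at h1
  exact h1

theorem finite_faces : t.faces.Finite :=
  S.powerset.finite_toSet.subset fun _ hs => Finset.mem_powerset.2 (t.subset_of_mem_faces hs)

theorem volume_convexHull_eq_zero_of_notMem_cells {s : Finset (Pt d)} (hs : s ∈ t.faces)
    (hs' : s ∉ t.cells) : volume (convexHull ℝ (s : Set (Pt d))) = 0 :=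
  volume_convexHull_eq_zero (t.indep hs) fun h => hs' ((t.mem_cells s).2 ⟨hs, h⟩)

theorem aedisjoint_cells :
    (t.cells : Set (Finset (Pt d))).Pairwise
      (Function.onFun (AEDisjoint volume) fun s => convexHull ℝ (s : Set (Pt d))) := by
  classical
  intro s hs r hr hne
  obtain ⟨hs1, hs2⟩ := (t.mem_cells s).1 hs
  obtain ⟨hr1, hr2⟩ := (t.mem_cells r).1 hr
  have h1 := t.inter_subset_convexHull hs1 hr1
  rw [← Finset.coe_inter] at h1
  refine measure_mono_null h1 (volume_convexHull_eq_zero ?_ ?_)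
  · exact (t.indep hs1).mono (Finset.coe_subset.2 Finset.inter_subset_left)
  · intro h
    have h2 : s ∩ r = s := Finset.eq_of_subset_of_card_le Finset.inter_subset_left (by omega)
    have h3 : s ∩ r = r := Finset.eq_of_subset_of_card_le Finset.inter_subset_right (by omega)
    exact hne (h2.symm.trans h3)

theorem convexHull_subset_of_mem_faces {s : Finset (Pt d)} (hs : s ∈ t.faces) :
    convexHull ℝ (s : Set (Pt d)) ⊆ convexHull ℝ (S : Set (Pt d)) :=
  convexHull_mono (Finset.coe_subset.2 (t.subset_of_mem_faces hs))

theorem volume_diff_cells :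
    volume (convexHull ℝ (S : Set (Pt d)) \ ⋃ s ∈ t.cells, convexHull ℝ (s : Set (Pt d))) = 0 := by
  have h : convexHull ℝ (S : Set (Pt d)) \ ⋃ s ∈ t.cells, convexHull ℝ (s : Set (Pt d)) ⊆
      ⋃ s ∈ t.faces \ (t.cells : Set (Finset (Pt d))), convexHull ℝ (s : Set (Pt d)) := by
    rintro x ⟨hx, hx'⟩
    rw [← t.space_eq, Geometry.SimplicialComplex.mem_space_iff] at hx
    obtain ⟨s, hs, hxs⟩ := hx
    refine Set.mem_biUnion ⟨hs, fun h => hx' ?_⟩ hxs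
    exact Set.mem_biUnion h hxs
  refine measure_mono_null h ((measure_biUnion_null_iff ?_).2 fun s hs => ?_)
  · exact (t.finite_faces.subset Set.sdiff_subset).countable
  · exact t.volume_convexHull_eq_zero_of_notMem_cells hs.1 hs.2

theorem convexHull_ae_eq_cells :
    (convexHull ℝ (S : Set (Pt d)) : Set (Pt d)) =ᵐ[volume]
      (⋃ s ∈ t.cells, convexHull ℝ (s : Set (Pt d)) : Set (Pt d)) := by
  refine Filter.EventuallyLE.antisymm (ae_le_set.2 t.volume_diff_cells)
    (Filter.Eventually.of_forall fun x hx => ?_)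
  obtain ⟨s, hs, hxs⟩ := Set.mem_iUnion₂.1 hx
  exact t.convexHull_subset_of_mem_faces ((t.mem_cells s).1 hs).1 hxs

theorem setIntegral_convexHull_eq_sum {g : Pt d → ℝ} (hg : Continuous g) :
    ∫ x in convexHull ℝ (S : Set (Pt d)), g x =
      ∑ s ∈ t.cells, ∫ x in convexHull ℝ (s : Set (Pt d)), g x := by
  have hU : (⋃ s ∈ t.cells, convexHull ℝ (s : Set (Pt d))) =
      ⋃ s : t.cells, convexHull ℝ ((s : Finset (Pt d)) : Set (Pt d)) :=
    (Set.iUnion_subtype (· ∈ t.cells) fun s =>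
      convexHull ℝ ((s : Finset (Pt d)) : Set (Pt d))).symm
  rw [setIntegral_congr_set t.convexHull_ae_eq_cells, hU,
    integral_iUnion_ae ?_ ?_ ?_, tsum_fintype, Finset.sum_coe_sort t.cells fun s =>
      ∫ x in convexHull ℝ (s : Set (Pt d)), g x]
  · intro s
    exact (isCompact_convexHull_coe _).measurableSet.nullMeasurableSet
  · intro s r hne
    exact t.aedisjoint_cells s.2 r.2 fun h => hne (Subtype.ext h)
  · refine (hg.continuousOn.integrableOn_compact (isCompact_convexHull_coe S)).mono_set
      (Set.iUnion_subset fun s => t.convexHull_subset_of_mem_faces ((t.mem_cells _).1 s.2).1)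

theorem C2_add_V :
    ((d : ℝ) + 1) ^ 2 * t.C2 + t.V =
        ((d : ℝ) + 1) * ((d : ℝ) + 2) *
          ∫ x in convexHull ℝ (S : Set (Pt d)), ‖x‖ ^ 2 := by
  rw [t.setIntegral_convexHull_eq_sum (by fun_prop), Finset.mul_sum, C2, V, Finset.mul_sum,
    ← Finset.sum_add_distrib]
  refine Finset.sum_congr rfl fun s hs => ?_
  obtain ⟨h1, h2⟩ := (t.mem_cells s).1 hs
  exact (setIntegral_norm_sq_simplex (t.indep h1) h2).symm

end Triangulation

/-! ### The lifted surface and the volume of the body below it -/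

/-- The lift of a point of `ℝ^d` to the paraboloid `y = ‖x‖²`. -/
def paraboloidLift (x : Pt d) : Pt d × ℝ := (x, ‖x‖ ^ 2)

/-- The part of the body below the lifted surface that lies over the simplex `s`. -/
def simplexBody (s : Finset (Pt d)) : Set (Pt d × ℝ) :=
  {w | 0 ≤ w.2 ∧ ∃ z : ℝ, (w.1, z) ∈ convexHull ℝ (paraboloidLift '' (s : Set (Pt d))) ∧ w.2 ≤ z}

theorem mem_convexHull_lift_iff {s : Finset (Pt d)} {x : Pt d} {z : ℝ} :
    (x, z) ∈ convexHull ℝ (paraboloidLift '' (s : Set (Pt d))) ↔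
      ∃ w : Pt d → ℝ, (∀ p ∈ s, 0 ≤ w p) ∧ ∑ p ∈ s, w p = 1 ∧ ∑ p ∈ s, w p • p = x ∧
        ∑ p ∈ s, w p * ‖p‖ ^ 2 = z := by
  classical
  have hinj : Function.Injective (paraboloidLift (d := d)) := fun x y h => congrArg Prod.fst h
  rw [← Finset.coe_image, Finset.mem_convexHull']
  have hsum : ∀ w : Pt d × ℝ → ℝ, (∑ y ∈ s.image paraboloidLift, w y • y = (x, z)) ↔
      (∑ p ∈ s, w (paraboloidLift p) • p = x ∧ ∑ p ∈ s, w (paraboloidLift p) * ‖p‖ ^ 2 = z) := by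
    intro w
    rw [Finset.sum_image hinj.injOn, Prod.ext_iff, Prod.fst_sum, Prod.snd_sum]
    rfl
  constructor
  · rintro ⟨w, h0, h1, h2⟩
    refine ⟨fun p => w (paraboloidLift p), fun p hp => h0 _ (Finset.mem_image_of_mem _ hp), ?_,
      (hsum w).1 h2⟩
    rwa [Finset.sum_image hinj.injOn] at h1
  · rintro ⟨w, h0, h1, h2⟩
    refine ⟨fun y => w y.1, fun y hy => ?_, ?_, (hsum _).2 h2⟩
    · obtain ⟨p, hp, rfl⟩ := Finset.mem_image.1 hy
      exact h0 p hp
    · rw [Finset.sum_image hinj.injOn]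
      exact h1

theorem mem_convexHull_of_mem_convexHull_lift {s : Finset (Pt d)} {x : Pt d} {z : ℝ}
    (h : (x, z) ∈ convexHull ℝ (paraboloidLift '' (s : Set (Pt d)))) :
    x ∈ convexHull ℝ (s : Set (Pt d)) := by
  obtain ⟨w, h0, h1, h2, -⟩ := mem_convexHull_lift_iff.1 h
  exact Finset.mem_convexHull'.2 ⟨w, h0, h1, h2⟩

theorem exists_mem_convexHull_lift {s : Finset (Pt d)} {x : Pt d}
    (h : x ∈ convexHull ℝ (s : Set (Pt d))) :
    ∃ z, (x, z) ∈ convexHull ℝ (paraboloidLift '' (s : Set (Pt d))) := by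
  obtain ⟨w, h0, h1, h2⟩ := Finset.mem_convexHull'.1 h
  exact ⟨_, mem_convexHull_lift_iff.2 ⟨w, h0, h1, h2, rfl⟩⟩

theorem nonneg_of_mem_convexHull_lift {s : Finset (Pt d)} {x : Pt d} {z : ℝ}
    (h : (x, z) ∈ convexHull ℝ (paraboloidLift '' (s : Set (Pt d)))) : 0 ≤ z := by
  obtain ⟨w, h0, -, -, h3⟩ := mem_convexHull_lift_iff.1 h
  rw [← h3]
  exact Finset.sum_nonneg fun p hp => mul_nonneg (h0 p hp) (by positivity)

theorem affineMap_sum_smul (L : Pt d →ᵃ[ℝ] ℝ) {s : Finset (Pt d)} {w : Pt d → ℝ}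
    (hw : ∑ p ∈ s, w p = 1) : L (∑ p ∈ s, w p • p) = ∑ p ∈ s, w p * L p := by
  have h1 : ∑ p ∈ s, w p • p = s.affineCombination ℝ id w := by
    rw [Finset.affineCombination_eq_linear_combination _ _ _ hw]; rfl
  rw [h1, Finset.map_affineCombination _ _ _ hw,
    Finset.affineCombination_eq_linear_combination _ _ _ hw]
  rfl

/-- Over a simplex the lifted surface is the graph of the affine interpolation. -/
theorem mem_convexHull_lift_iff_of_affineMap {s : Finset (Pt d)} {L : Pt d →ᵃ[ℝ] ℝ}
    (hL : ∀ p ∈ s, L p = ‖p‖ ^ 2) {x : Pt d} {z : ℝ} :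
    (x, z) ∈ convexHull ℝ (paraboloidLift '' (s : Set (Pt d))) ↔
      x ∈ convexHull ℝ (s : Set (Pt d)) ∧ z = L x := by
  have key : ∀ w : Pt d → ℝ, ∑ p ∈ s, w p = 1 →
      ∑ p ∈ s, w p * ‖p‖ ^ 2 = L (∑ p ∈ s, w p • p) := by
    intro w hw
    rw [affineMap_sum_smul L hw]
    exact Finset.sum_congr rfl fun p hp => by rw [hL p hp]
  rw [mem_convexHull_lift_iff, Finset.mem_convexHull']
  constructor
  · rintro ⟨w, h0, h1, h2, h3⟩
    exact ⟨⟨w, h0, h1, h2⟩, by rw [← h3, key w h1, h2]⟩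
  · rintro ⟨⟨w, h0, h1, h2⟩, rfl⟩
    exact ⟨w, h0, h1, h2, by rw [key w h1, h2]⟩

theorem isCompact_simplexBody (s : Finset (Pt d)) : IsCompact (simplexBody s) := by
  have h1 : IsCompact (convexHull ℝ (paraboloidLift '' (s : Set (Pt d))) ×ˢ Set.Icc (0 : ℝ) 1) :=
    ((s.finite_toSet.image _).isCompact_convexHull ℝ).prod isCompact_Icc
  -- Points below the surface are obtained from points of the surface by scaling the height.
  have h2 : simplexBody s = (fun q : (Pt d × ℝ) × ℝ => (q.1.1, q.2 * q.1.2)) ''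
      (convexHull ℝ (paraboloidLift '' (s : Set (Pt d))) ×ˢ Set.Icc (0 : ℝ) 1) := by
    ext ⟨x, y⟩
    constructor
    · rintro ⟨hy, z, hz, hyz⟩
      simp only at hy hz hyz
      have hz0 := nonneg_of_mem_convexHull_lift hz
      refine ⟨((x, z), y / z), ⟨hz, div_nonneg hy hz0, div_le_one_of_le₀ hyz hz0⟩, ?_⟩
      simp only [Prod.mk.injEq, true_and]
      rcases hz0.eq_or_lt with h | h
      · rw [← h, mul_zero]; exact le_antisymm hy (h ▸ hyz)
      · exact div_mul_cancel₀ _ h.ne'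
    · rintro ⟨⟨⟨x', z⟩, r⟩, ⟨hz, hr0, hr1⟩, h⟩
      simp only [Prod.mk.injEq] at h
      obtain ⟨rfl, rfl⟩ := h
      have hz0 := nonneg_of_mem_convexHull_lift hz
      exact ⟨mul_nonneg hr0 hz0, z, hz, mul_le_of_le_one_left hz0 hr1⟩
  rw [h2]
  exact h1.image (by fun_prop)

theorem simplexBody_subset (s : Finset (Pt d)) :
    simplexBody s ⊆ convexHull ℝ (s : Set (Pt d)) ×ˢ Set.univ := by
  rintro w ⟨-, z, hz, -⟩
  exact ⟨mem_convexHull_of_mem_convexHull_lift hz, trivial⟩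

theorem volume_prod_univ_eq_zero {A : Set (Pt d)} (hA : volume A = 0) :
    volume (A ×ˢ (Set.univ : Set ℝ)) = 0 := by
  rw [Measure.volume_eq_prod, Measure.prod_prod, hA, zero_mul]

theorem volume_simplexBody {s : Finset (Pt d)} (hs : AffineIndependent ℝ ((↑) : s → Pt d))
    (hcard : s.card = d + 1) :
    volume (simplexBody s) = ENNReal.ofReal ((∑ x ∈ s, ‖x‖ ^ 2) * vol s / ((d : ℝ) + 1)) := by
  obtain ⟨L, hL⟩ := exists_affineMap_eq hs hcard fun p => ‖p‖ ^ 2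
  have hK := isCompact_convexHull_coe s
  have hL0 : ∀ x ∈ convexHull ℝ (s : Set (Pt d)), 0 ≤ L x := fun x hx =>
    nonneg_of_mem_convexHull_lift ((mem_convexHull_lift_iff_of_affineMap hL).2 ⟨hx, rfl⟩)
  have hsec : ∀ x, volume (Prod.mk x ⁻¹' simplexBody s) =
      (convexHull ℝ (s : Set (Pt d))).indicator (fun x => ENNReal.ofReal (L x)) x := by
    intro x
    by_cases hx : x ∈ convexHull ℝ (s : Set (Pt d))
    · have h1 : Prod.mk x ⁻¹' simplexBody s = Set.Icc 0 (L x) := by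
        ext y
        constructor
        · rintro ⟨hy, z, hz, hyz⟩
          rw [((mem_convexHull_lift_iff_of_affineMap hL).1 hz).2] at hyz
          exact ⟨hy, hyz⟩
        · rintro ⟨hy, hyz⟩
          exact ⟨hy, L x, (mem_convexHull_lift_iff_of_affineMap hL).2 ⟨hx, rfl⟩, hyz⟩
      rw [h1, Set.indicator_of_mem hx, Real.volume_Icc, sub_zero]
    · have h1 : Prod.mk x ⁻¹' simplexBody s = ∅ :=
        Set.eq_empty_of_forall_notMem fun y hy => hx (simplexBody_subset s hy).1
      rw [h1, Set.indicator_of_notMem hx, measure_empty]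
  rw [Measure.volume_eq_prod, Measure.prod_apply (isCompact_simplexBody s).measurableSet]
  simp only [hsec]
  rw [lintegral_indicator hK.measurableSet, ← ofReal_integral_eq_lintegral_ofReal,
    setIntegral_affineMap_simplex hs hcard, Finset.sum_congr rfl hL]
  · exact L.continuous_of_finiteDimensional.continuousOn.integrableOn_compact hK
  · exact (ae_restrict_iff' hK.measurableSet).2 (Filter.Eventually.of_forall hL0)

namespace Triangulation

variable {S : Finset (Pt d)} (t : Triangulation S)

theorem mem_liftedSurface_iff {w : Pt d × ℝ} :
    w ∈ t.liftedSurface ↔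
      ∃ s ∈ t.faces, w ∈ convexHull ℝ (paraboloidLift '' (s : Set (Pt d))) := by
  rw [liftedSurface, Set.mem_iUnion₂]
  simp only [exists_prop]
  rfl

theorem bodyBelow_eq : t.bodyBelow = ⋃ s ∈ t.faces, simplexBody s := by
  ext w
  rw [Set.mem_iUnion₂]
  constructor
  · rintro ⟨h0, z, hz, hwz⟩
    obtain ⟨s, hs, hz⟩ := t.mem_liftedSurface_iff.1 hz
    exact ⟨s, hs, h0, z, hz, hwz⟩
  · rintro ⟨s, hs, h0, z, hz, hwz⟩
    exact ⟨h0, z, t.mem_liftedSurface_iff.2 ⟨s, hs, hz⟩, hwz⟩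

theorem isCompact_bodyBelow : IsCompact t.bodyBelow := by
  rw [bodyBelow_eq]
  exact t.finite_faces.isCompact_biUnion fun s _ => isCompact_simplexBody s

theorem bodyBelow_ae_eq :
    (t.bodyBelow : Set (Pt d × ℝ)) =ᵐ[volume]
      (⋃ s ∈ t.cells, simplexBody s : Set (Pt d × ℝ)) := by
  refine Filter.EventuallyLE.antisymm (ae_le_set.2 ?_)
    (Filter.Eventually.of_forall fun x hx => ?_)
  · have h : t.bodyBelow \ ⋃ s ∈ t.cells, simplexBody s ⊆
        ⋃ s ∈ t.faces \ (t.cells : Set (Finset (Pt d))), simplexBody s := by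
      rintro x ⟨hx, hx'⟩
      rw [bodyBelow_eq, Set.mem_iUnion₂] at hx
      obtain ⟨s, hs, hxs⟩ := hx
      exact Set.mem_biUnion ⟨hs, fun h => hx' (Set.mem_biUnion h hxs)⟩ hxs
    refine measure_mono_null h ((measure_biUnion_null_iff ?_).2 fun s hs => ?_)
    · exact (t.finite_faces.subset Set.sdiff_subset).countable
    · exact measure_mono_null (simplexBody_subset s) (volume_prod_univ_eq_zero
        (t.volume_convexHull_eq_zero_of_notMem_cells hs.1 hs.2))
  · obtain ⟨s, hs, hxs⟩ := Set.mem_iUnion₂.1 hx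
    change x ∈ t.bodyBelow
    rw [bodyBelow_eq]
    exact Set.mem_biUnion ((t.mem_cells s).1 hs).1 hxs

theorem volume_bodyBelow :
    volume t.bodyBelow = ENNReal.ofReal (t.V / ((d : ℝ) + 1)) := by
  rw [measure_congr t.bodyBelow_ae_eq, measure_biUnion_finset₀]
  · rw [V, Finset.sum_div, ENNReal.ofReal_sum_of_nonneg]
    · refine Finset.sum_congr rfl fun s hs => ?_
      obtain ⟨h1, h2⟩ := (t.mem_cells s).1 hs
      exact volume_simplexBody (t.indep h1) h2
    · intro s _
      have := vol_nonneg s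
      positivity
  · intro s hs r hr hne
    have h := t.aedisjoint_cells hs hr hne
    refine measure_mono_null ?_ (volume_prod_univ_eq_zero h)
    intro w hw
    exact ⟨⟨(simplexBody_subset s hw.1).1, (simplexBody_subset r hw.2).1⟩, trivial⟩
  · exact fun s _ => (isCompact_simplexBody s).measurableSet.nullMeasurableSet

theorem V_nonneg : 0 ≤ t.V :=
  Finset.sum_nonneg fun s _ => mul_nonneg (by positivity) (vol_nonneg s)

end Triangulation

/-! ### Nearest sites and supporting affine functions -/

variable {S : Finset (Pt d)}

/-- The power `‖p‖² - 2⟪c, p⟫` of the site `p` with respect to `c`: the squared distance from `c`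
to `p` up to the term `‖c‖²`, which does not depend on `p`. It is affine in `c`. -/
def sitePower (c p : Pt d) : ℝ := ‖p‖ ^ 2 - 2 * inner ℝ c p

theorem mem_voronoiCell_iff {c p : Pt d} :
    c ∈ voronoiCell S p ↔ ∀ q ∈ S, sitePower c p ≤ sitePower c q := by
  have h : ∀ q : Pt d, dist c p ≤ dist c q ↔ sitePower c p ≤ sitePower c q := by
    intro q
    rw [← sq_le_sq₀ dist_nonneg dist_nonneg, dist_eq_norm, dist_eq_norm, norm_sub_sq_real,
      norm_sub_sq_real, sitePower, sitePower]
    constructor <;> intro h <;> linarith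
  constructor
  · intro hc q hq
    by_cases hqp : q = p
    · rw [hqp]
    · exact (h q).1 (hc q hq hqp)
  · exact fun hc q hq _ => (h q).2 (hc q hq)

theorem sitePower_add_smul (c u p q : Pt d) (r : ℝ) :
    sitePower (c + r • u) q - sitePower (c + r • u) p =
      sitePower c q - sitePower c p - 2 * r * inner ℝ u (q - p) := by
  simp only [sitePower, inner_add_left, real_inner_smul_left, inner_sub_right]
  ring

open Classical in
/-- The sites of `S` whose Voronoi cells contain `c`, that is, the sites nearest to `c`. -/
def nearestSites (S : Finset (Pt d)) (c : Pt d) : Finset (Pt d) :=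
  S.filter fun p => c ∈ voronoiCell S p

theorem mem_nearestSites {c p : Pt d} :
    p ∈ nearestSites S c ↔ p ∈ S ∧ ∀ q ∈ S, sitePower c p ≤ sitePower c q := by
  classical
  rw [nearestSites, Finset.mem_filter, mem_voronoiCell_iff]

theorem nearestSites_subset (c : Pt d) : nearestSites S c ⊆ S :=
  fun _ hp => (mem_nearestSites.1 hp).1

theorem nearestSites_nonempty (hS : S.Nonempty) (c : Pt d) : (nearestSites S c).Nonempty := by
  obtain ⟨p, hp, h⟩ := S.exists_min_image (sitePower c) hS
  exact ⟨p, mem_nearestSites.2 ⟨hp, h⟩⟩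

theorem mem_voronoiDual_iff {s : Finset (Pt d)} :
    s ∈ voronoiDual S ↔ s.Nonempty ∧ ∃ c, s ⊆ nearestSites S c := by
  constructor
  · rintro ⟨h1, h2, c, hc⟩
    rw [Set.mem_iInter₂] at hc
    exact ⟨h1, c, fun p hp => mem_nearestSites.2 ⟨h2 hp, mem_voronoiCell_iff.1 (hc p hp)⟩⟩
  · rintro ⟨h1, c, hc⟩
    refine ⟨h1, hc.trans (nearestSites_subset c), c, Set.mem_iInter₂.2 fun p hp => ?_⟩
    exact mem_voronoiCell_iff.2 (mem_nearestSites.1 (hc hp)).2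

/-- Every center `c` yields an affine function below the paraboloid at all sites that touches it
exactly at the sites nearest to `c`. -/
theorem exists_supporting_affineMap (hS : S.Nonempty) (c : Pt d) :
    ∃ h : Pt d →ᵃ[ℝ] ℝ, (∀ p ∈ S, h p ≤ ‖p‖ ^ 2) ∧
      ∀ p ∈ S, h p = ‖p‖ ^ 2 ↔ p ∈ nearestSites S c := by
  obtain ⟨p₀, hp₀, hmin⟩ := S.exists_min_image (sitePower c) hS
  let h : Pt d →ᵃ[ℝ] ℝ := ((2 : ℝ) • innerₛₗ ℝ c).toAffineMap + AffineMap.const ℝ _ (sitePower c p₀)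
  have hh : ∀ p, ‖p‖ ^ 2 - h p = sitePower c p - sitePower c p₀ := by
    intro p
    have : h p = 2 * inner ℝ c p + sitePower c p₀ := rfl
    rw [this]
    simp only [sitePower]
    ring
  refine ⟨h, fun p hp => ?_, fun p hp => ⟨fun he => ?_, fun hn => ?_⟩⟩
  · have := hh p
    have := hmin p hp
    linarith
  · refine mem_nearestSites.2 ⟨hp, fun q hq => ?_⟩
    have := hh p
    have := hmin q hq
    linarith
  · have h1 := hh p
    have h2 := hmin p hp
    have h3 := (mem_nearestSites.1 hn).2 p₀ hp₀
    linarith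

theorem affineMap_le_of_mem_convexHull_lift {h : Pt d →ᵃ[ℝ] ℝ} {s : Finset (Pt d)}
    (hle : ∀ p ∈ s, h p ≤ ‖p‖ ^ 2) {x : Pt d} {z : ℝ}
    (hz : (x, z) ∈ convexHull ℝ (paraboloidLift '' (s : Set (Pt d)))) : h x ≤ z := by
  obtain ⟨w, h0, h1, rfl, rfl⟩ := mem_convexHull_lift_iff.1 hz
  rw [affineMap_sum_smul h h1]
  exact Finset.sum_le_sum fun p hp => mul_le_mul_of_nonneg_left (hle p hp) (h0 p hp)

/-- Complementary slackness: if a convex combination of lifted points lies on a supporting affine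
function, then so does every point of positive weight. -/
theorem affineMap_eq_of_weight_pos {h : Pt d →ᵃ[ℝ] ℝ} {s : Finset (Pt d)}
    (hle : ∀ p ∈ s, h p ≤ ‖p‖ ^ 2) {w : Pt d → ℝ} (h0 : ∀ p ∈ s, 0 ≤ w p)
    (h1 : ∑ p ∈ s, w p = 1) (hw : ∑ p ∈ s, w p * ‖p‖ ^ 2 ≤ h (∑ p ∈ s, w p • p))
    {p : Pt d} (hp : p ∈ s) (hpos : 0 < w p) : h p = ‖p‖ ^ 2 := by
  rw [affineMap_sum_smul h h1] at hw
  have hterm : ∀ q ∈ s, w q * h q ≤ w q * ‖q‖ ^ 2 := fun q hq =>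
    mul_le_mul_of_nonneg_left (hle q hq) (h0 q hq)
  have heq := (Finset.sum_eq_sum_iff_of_le hterm).1
    (le_antisymm (Finset.sum_le_sum hterm) hw) p hp
  exact mul_left_cancel₀ hpos.ne' heq

/-! ### Genericity makes the sets of nearest sites affinely independent -/

theorem nonempty_of_affineSpan_eq_top (hS : affineSpan ℝ (S : Set (Pt d)) = ⊤) : S.Nonempty := by
  by_contra h
  rw [Finset.not_nonempty_iff_eq_empty.1 h, Finset.coe_empty, AffineSubspace.span_empty] at hS
  exact AffineSubspace.bot_ne_top ℝ (Pt d) (Pt d) hS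

theorem exists_inner_ne_zero_of_affineSpan_eq_top (hS : affineSpan ℝ (S : Set (Pt d)) = ⊤)
    {p₀ u : Pt d} (hp₀ : p₀ ∈ S) (hu : u ≠ 0) : ∃ q ∈ S, inner ℝ u (q - p₀) ≠ 0 := by
  by_contra! hcon
  have h1 := (AffineSubspace.affineSpan_eq_top_iff_vectorSpan_eq_top_of_nonempty ℝ (Pt d) (Pt d)
    (s := (S : Set (Pt d))) ⟨p₀, hp₀⟩).1 hS
  rw [vectorSpan_eq_span_vsub_set_right ℝ (Finset.mem_coe.2 hp₀)] at h1
  have h2 : Submodule.span ℝ ((fun x => x -ᵥ p₀) '' (S : Set (Pt d))) ≤ (ℝ ∙ u)ᗮ := by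
    rw [Submodule.span_le]
    rintro _ ⟨q, hq, rfl⟩
    exact Submodule.mem_orthogonal_singleton_iff_inner_right.2 (hcon q hq)
  rw [h1] at h2
  have h3 : inner ℝ u u = 0 :=
    Submodule.mem_orthogonal_singleton_iff_inner_right.1 (h2 (Submodule.mem_top (x := u)))
  exact hu (inner_self_eq_zero.1 h3)

/-- If the sites nearest to `c` do not span, then `c` can be moved orthogonally to their span,
keeping them equidistant, until one more site becomes nearest. -/
theorem exists_nearestSites_ssubset (hS : affineSpan ℝ (S : Set (Pt d)) = ⊤) {c : Pt d}
    (hc : affineSpan ℝ (nearestSites S c : Set (Pt d)) ≠ ⊤) :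
    ∃ c', nearestSites S c ⊂ nearestSites S c' := by
  classical
  obtain ⟨p₀, hp₀⟩ := nearestSites_nonempty (nonempty_of_affineSpan_eq_top hS) c
  have hp₀' := mem_nearestSites.1 hp₀
  obtain ⟨u, hu0, hu⟩ : ∃ u : Pt d, u ≠ 0 ∧ ∀ p ∈ nearestSites S c, inner ℝ u (p - p₀) = 0 := by
    rw [Ne, AffineSubspace.affineSpan_eq_top_iff_vectorSpan_eq_top_of_nonempty ℝ (Pt d) (Pt d)
      (s := (nearestSites S c : Set (Pt d))) ⟨p₀, hp₀⟩, ← Submodule.orthogonal_eq_bot_iff,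
      Submodule.eq_bot_iff] at hc
    push Not at hc
    obtain ⟨u, hu, hu0⟩ := hc
    exact ⟨u, hu0, fun p hp => (Submodule.mem_orthogonal' _ u).1 hu _
      (vsub_mem_vectorSpan ℝ hp hp₀)⟩
  -- After a change of sign, some site lies ahead in the direction `u`.
  obtain ⟨v, hv, q₀, hq₀, hq₀v⟩ : ∃ v : Pt d, (∀ p ∈ nearestSites S c, inner ℝ v (p - p₀) = 0) ∧
      ∃ q ∈ S, 0 < inner ℝ v (q - p₀) := by
    obtain ⟨q, hq, hqu⟩ := exists_inner_ne_zero_of_affineSpan_eq_top hS hp₀'.1 hu0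
    rcases lt_or_gt_of_ne hqu with h | h
    · refine ⟨-u, fun p hp => by rw [inner_neg_left, hu p hp, neg_zero], q, hq, ?_⟩
      rw [inner_neg_left]
      exact neg_pos.2 h
    · exact ⟨u, hu, q, hq, h⟩
  -- The first of the sites ahead that is reached determines how far `c` moves.
  obtain ⟨q, hq, hmin⟩ := (S.filter fun q => 0 < inner ℝ v (q - p₀)).exists_min_image
    (fun q => (sitePower c q - sitePower c p₀) / (2 * inner ℝ v (q - p₀)))
    ⟨q₀, Finset.mem_filter.2 ⟨hq₀, hq₀v⟩⟩
  rw [Finset.mem_filter] at hq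
  obtain ⟨hqS, hqv⟩ := hq
  set r := (sitePower c q - sitePower c p₀) / (2 * inner ℝ v (q - p₀)) with hr
  have hr0 : 0 ≤ r := div_nonneg (sub_nonneg.2 (hp₀'.2 q hqS)) (by positivity)
  have hge : ∀ y ∈ S, sitePower (c + r • v) p₀ ≤ sitePower (c + r • v) y := by
    intro y hy
    have h1 := sitePower_add_smul c v p₀ y r
    by_cases hyv : 0 < inner ℝ v (y - p₀)
    · have h2 := hmin y (Finset.mem_filter.2 ⟨hy, hyv⟩)
      rw [le_div_iff₀ (by positivity)] at h2
      linarith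
    · have h2 : r * inner ℝ v (y - p₀) ≤ 0 := mul_nonpos_of_nonneg_of_nonpos hr0 (not_lt.1 hyv)
      have h3 := hp₀'.2 y hy
      linarith
  have hmem : ∀ y ∈ S, sitePower (c + r • v) y = sitePower (c + r • v) p₀ →
      y ∈ nearestSites S (c + r • v) := fun y hy he =>
    mem_nearestSites.2 ⟨hy, fun z hz => he.trans_le (hge z hz)⟩
  refine ⟨c + r • v, Finset.ssubset_iff_subset_ne.2 ⟨fun p hp => ?_, fun he => ?_⟩⟩
  · have hp' := mem_nearestSites.1 hp
    refine hmem p hp'.1 ?_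
    have h1 := sitePower_add_smul c v p₀ p r
    rw [hv p hp, mul_zero, sub_zero, le_antisymm (hp'.2 p₀ hp₀'.1) (hp₀'.2 p hp'.1), sub_self] at h1
    exact sub_eq_zero.1 h1
  · have hq' : q ∈ nearestSites S (c + r • v) := by
      refine hmem q hqS ?_
      have h1 := sitePower_add_smul c v p₀ q r
      have h2 : r * (2 * inner ℝ v (q - p₀)) = sitePower c q - sitePower c p₀ :=
        div_mul_cancel₀ _ (by positivity)
      linarith
    rw [← he] at hq'
    exact hqv.ne' (hv q hq')

theorem affineIndependent_of_affineSpan_eq_top {s : Finset (Pt d)}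
    (hs : affineSpan ℝ (s : Set (Pt d)) = ⊤) (hcard : s.card ≤ d + 1) :
    AffineIndependent ℝ ((↑) : s → Pt d) := by
  have hne := nonempty_of_affineSpan_eq_top hs
  obtain ⟨m, hm⟩ : ∃ m, s.card = m + 1 := Nat.exists_eq_succ_of_ne_zero hne.card_pos.ne'
  rw [affineIndependent_iff_le_finrank_vectorSpan ℝ _ (n := m) (by rw [Fintype.card_coe, hm]),
    Subtype.range_coe_subtype]
  have h1 := (AffineSubspace.affineSpan_eq_top_iff_vectorSpan_eq_top_of_nonempty ℝ (Pt d) (Pt d)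
    (s := (s : Set (Pt d))) hne).1 hs
  change m ≤ Module.finrank ℝ (vectorSpan ℝ (s : Set (Pt d)))
  rw [h1, finrank_top, finrank_euclideanSpace_fin]
  omega

/-- A dependent set of nearest sites could be enlarged again and again by moving the center, which
contradicts the bound on the number of Voronoi cells through a point. -/
theorem affineIndependent_nearestSites (hS : IsGeneric S) (c : Pt d) :
    AffineIndependent ℝ ((↑) : nearestSites S c → Pt d) := by
  by_contra hdep
  have hcard : ∀ c, (nearestSites S c).card ≤ d + 1 := hS.card_le
  have key : ∀ n : ℕ, ∃ c, ¬ AffineIndependent ℝ ((↑) : nearestSites S c → Pt d) ∧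
      n ≤ (nearestSites S c).card := by
    intro n
    induction n with
    | zero => exact ⟨c, hdep, Nat.zero_le _⟩
    | succ n ih =>
      obtain ⟨c₁, h1, h2⟩ := ih
      obtain ⟨c₂, h3⟩ := exists_nearestSites_ssubset hS.affineSpan_eq_top (c := c₁) fun h =>
        h1 (affineIndependent_of_affineSpan_eq_top h (hcard c₁))
      exact ⟨c₂, fun h => h1 (h.mono (Finset.coe_subset.2 h3.subset)),
        Nat.succ_le_of_lt (h2.trans_lt (Finset.card_lt_card h3))⟩
  obtain ⟨c', -, h⟩ := key (d + 2)
  have := hcard c'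
  omega

/-! ### The Delaunay triangulation -/

/-- Two Delaunay simplices meet in a common face: at a common point both affine interpolations
agree with the lower convex hull of the lifted sites, so by complementary slackness the vertices
that carry the point in the first simplex are nearest sites for the second one. -/
theorem convexHull_inter_subset_of_subset_nearestSites (hS : IsGeneric S) {c₁ c₂ : Pt d}
    {s₁ s₂ : Finset (Pt d)} (h₁ : s₁ ⊆ nearestSites S c₁) (h₂ : s₂ ⊆ nearestSites S c₂) :
    convexHull ℝ (s₁ : Set (Pt d)) ∩ convexHull ℝ (s₂ : Set (Pt d)) ⊆
      convexHull ℝ ((s₁ : Set (Pt d)) ∩ s₂) := by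
  classical
  rintro x ⟨hx₁, hx₂⟩
  have hne := nonempty_of_affineSpan_eq_top hS.affineSpan_eq_top
  obtain ⟨f₁, hf₁, he₁⟩ := exists_supporting_affineMap hne c₁
  obtain ⟨f₂, hf₂, he₂⟩ := exists_supporting_affineMap hne c₂
  have hS₁ : s₁ ⊆ S := h₁.trans (nearestSites_subset c₁)
  have hS₂ : s₂ ⊆ S := h₂.trans (nearestSites_subset c₂)
  have hle : f₁ x ≤ f₂ x := by
    have h := (mem_convexHull_lift_iff_of_affineMap (L := f₂)
      fun p hp => (he₂ p (hS₂ hp)).2 (h₂ hp)).2 ⟨hx₂, rfl⟩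
    exact affineMap_le_of_mem_convexHull_lift (fun p hp => hf₁ p (hS₂ hp)) h
  obtain ⟨w, hw0, hw1, rfl⟩ := Finset.mem_convexHull'.1 hx₁
  have hslack : ∀ p ∈ s₁, w p ≠ 0 → p ∈ nearestSites S c₂ := by
    intro p hp hwp
    refine (he₂ p (hS₁ hp)).1 (affineMap_eq_of_weight_pos (fun q hq => hf₂ q (hS₁ hq)) hw0 hw1 ?_ hp
      ((hw0 p hp).lt_of_ne' hwp))
    refine le_trans (le_of_eq ?_) hle
    rw [affineMap_sum_smul f₁ hw1]
    exact Finset.sum_congr rfl fun q hq => by rw [(he₁ q (hS₁ hq)).2 (h₁ hq)]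
  have hx₃ : ∑ p ∈ s₁, w p • p ∈
      convexHull ℝ ((s₁.filter (· ∈ nearestSites S c₂) : Finset (Pt d)) : Set (Pt d)) := by
    refine Finset.mem_convexHull'.2 ⟨w, fun p hp => hw0 p (Finset.mem_of_mem_filter p hp), ?_, ?_⟩
    · rw [← hw1]
      exact Finset.sum_filter_of_ne hslack
    · exact Finset.sum_filter_of_ne fun p hp hne =>
        hslack p hp fun h => hne (by rw [h, zero_smul])
  have hinter := (affineIndependent_nearestSites hS c₂).convexHull_inter
    (t₁ := s₁.filter (· ∈ nearestSites S c₂)) (t₂ := s₂)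
    (fun p hp => (Finset.mem_filter.1 hp).2) h₂
  have hx₄ := hinter.symm.subset ⟨hx₃, hx₂⟩
  refine convexHull_mono (fun p hp => ?_) hx₄
  exact ⟨(Finset.mem_filter.1 hp.1).1, hp.2⟩

/-- The dual function `c ↦ min_p (‖p‖² - 2⟪c, p - x⟫)`: the height at `x` of the highest affine
function of slope `2c` below the lifted sites. -/
def supportHeight (S : Finset (Pt d)) (hS : S.Nonempty) (x c : Pt d) : ℝ :=
  S.inf' hS fun p => ‖p‖ ^ 2 - 2 * inner ℝ c (p - x)

theorem exists_forall_supportHeight_le (hS : S.Nonempty) {x : Pt d}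
    (hx : x ∈ interior (convexHull ℝ (S : Set (Pt d)))) :
    ∃ c, ∀ c', supportHeight S hS x c' ≤ supportHeight S hS x c := by
  obtain ⟨r, hr, hball⟩ := Metric.nhds_basis_closedBall.mem_iff.1 (mem_interior_iff_mem_nhds.1 hx)
  obtain ⟨q, -, hq⟩ := S.exists_max_image (fun p : Pt d => ‖p‖ ^ 2) hS
  refine Continuous.exists_forall_ge (Continuous.finset_inf'_apply hS fun p _ => by fun_prop) ?_
  have hbound : ∀ c, supportHeight S hS x c ≤ ‖q‖ ^ 2 + -(2 * r) * ‖c‖ := by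
    intro c
    -- The point `y` of the ball around `x` that is farthest in the direction of `c`.
    let y := x + (r / ‖c‖) • c
    have hy : y ∈ convexHull ℝ (S : Set (Pt d)) := by
      refine hball ?_
      rw [Metric.mem_closedBall, dist_eq_norm, add_sub_cancel_left, norm_smul, Real.norm_eq_abs,
        abs_div, abs_norm, abs_of_pos hr]
      rcases eq_or_ne ‖c‖ 0 with h | h
      · rw [h, mul_zero]; exact hr.le
      · exact (div_mul_cancel₀ r h).le
    have hcy : inner ℝ c (y - x) = r * ‖c‖ := by
      rw [add_sub_cancel_left, real_inner_smul_right, real_inner_self_eq_norm_sq]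
      rcases eq_or_ne ‖c‖ 0 with h | h
      · rw [h]; simp
      · field_simp
    obtain ⟨p, hp, hpy⟩ : ∃ p ∈ S, inner ℝ c y ≤ inner ℝ c p := by
      by_contra! hcon
      have hconv : Convex ℝ {z : Pt d | inner ℝ c z < inner ℝ c y} :=
        convex_halfSpace_lt (innerₛₗ ℝ c).isLinear _
      have hyy : inner ℝ c y < inner ℝ c y := convexHull_min (fun z hz => hcon z hz) hconv hy
      exact lt_irrefl _ hyy
    have h1 : supportHeight S hS x c ≤ ‖p‖ ^ 2 - 2 * inner ℝ c (p - x) := Finset.inf'_le _ hp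
    have h2 := hq p hp
    rw [inner_sub_right] at h1 hcy
    linarith
  refine Filter.tendsto_atBot_mono hbound (Filter.tendsto_atBot_add_const_left _ _ ?_)
  exact tendsto_norm_cocompact_atTop.const_mul_atTop_of_neg (by linarith)

/-- At a maximizer `c` of the dual function, `x` lies in the convex hull of the sites nearest to
`c`: otherwise a direction that separates them increases the dual function. -/
theorem exists_mem_convexHull_nearestSites_of_mem_interior {x : Pt d}
    (hx : x ∈ interior (convexHull ℝ (S : Set (Pt d)))) :
    ∃ c, x ∈ convexHull ℝ (nearestSites S c : Set (Pt d)) := by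
  have hS : S.Nonempty := Finset.coe_nonempty.1 (convexHull_nonempty_iff.1 ⟨x, interior_subset hx⟩)
  obtain ⟨c, hc⟩ := exists_forall_supportHeight_le hS hx
  refine ⟨c, ?_⟩
  by_contra hcon
  obtain ⟨f, a, hf, ha⟩ := geometric_hahn_banach_closed_point (convex_convexHull ℝ _)
    (isCompact_convexHull_coe (nearestSites S c)).isClosed hcon
  let v := (InnerProductSpace.toDual ℝ (Pt d)).symm f
  have hfv : ∀ y, f y = inner ℝ v y := fun y => (InnerProductSpace.toDual_symm_apply).symm
  have hval : ∀ p, ‖p‖ ^ 2 - 2 * inner ℝ c (p - x) = sitePower c p + 2 * inner ℝ c x := by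
    intro p
    rw [inner_sub_right, sitePower]
    ring
  have hev : ∀ᶠ ε in nhdsWithin (0 : ℝ) (Set.Ioi 0), ∀ p ∈ S,
      supportHeight S hS x c < ‖p‖ ^ 2 - 2 * inner ℝ (c + ε • v) (p - x) := by
    rw [Filter.eventually_all_finset]
    intro p hp
    have hle : supportHeight S hS x c ≤ ‖p‖ ^ 2 - 2 * inner ℝ c (p - x) := Finset.inf'_le _ hp
    by_cases hpc : p ∈ nearestSites S c
    · filter_upwards [self_mem_nhdsWithin] with ε hε
      have h1 : inner ℝ v (p - x) < 0 := by
        rw [inner_sub_right, ← hfv, ← hfv]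
        linarith [hf p (subset_convexHull ℝ _ hpc)]
      have h2 := mul_neg_of_pos_of_neg (Set.mem_Ioi.1 hε) h1
      rw [inner_add_left, real_inner_smul_left]
      linarith
    · have hlt : supportHeight S hS x c < ‖p‖ ^ 2 - 2 * inner ℝ (c + (0 : ℝ) • v) (p - x) := by
        rw [zero_smul, add_zero]
        obtain ⟨q, hq⟩ := nearestSites_nonempty hS c
        have hqc := mem_nearestSites.1 hq
        have h1 : supportHeight S hS x c ≤ ‖q‖ ^ 2 - 2 * inner ℝ c (q - x) := Finset.inf'_le _ hqc.1
        rw [hval] at h1 ⊢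
        have h2 : sitePower c q < sitePower c p := by
          by_contra hle'
          exact hpc (mem_nearestSites.2 ⟨hp, fun y hy => (not_lt.1 hle').trans (hqc.2 y hy)⟩)
        linarith
      have hcont : Continuous fun ε : ℝ => ‖p‖ ^ 2 - 2 * inner ℝ (c + ε • v) (p - x) := by fun_prop
      exact (hcont.continuousAt.eventually (lt_mem_nhds hlt)).filter_mono nhdsWithin_le_nhds
  obtain ⟨ε, hε⟩ := hev.exists
  exact ((Finset.lt_inf'_iff hS).2 hε).not_ge (hc (c + ε • v))

theorem finite_voronoiDual (S : Finset (Pt d)) : (voronoiDual S).Finite :=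
  S.powerset.finite_toSet.subset fun _ hs => Finset.mem_powerset.2 hs.2.1

theorem convexHull_subset_closure_interior (hS : affineSpan ℝ (S : Set (Pt d)) = ⊤) :
    convexHull ℝ (S : Set (Pt d)) ⊆ closure (interior (convexHull ℝ (S : Set (Pt d)))) := by
  rw [(convex_convexHull ℝ _).closure_interior_eq_closure_of_nonempty_interior
    (interior_convexHull_nonempty_iff_affineSpan_eq_top.2 hS)]
  exact subset_closure

theorem exists_mem_voronoiDual_of_mem_convexHull (hS : affineSpan ℝ (S : Set (Pt d)) = ⊤)
    {x : Pt d} (hx : x ∈ convexHull ℝ (S : Set (Pt d))) :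
    ∃ s ∈ voronoiDual S, x ∈ convexHull ℝ (s : Set (Pt d)) := by
  have hne := nonempty_of_affineSpan_eq_top hS
  have hclosed : IsClosed (⋃ s ∈ voronoiDual S, convexHull ℝ (s : Set (Pt d))) :=
    (finite_voronoiDual S).isClosed_biUnion fun s _ => (isCompact_convexHull_coe s).isClosed
  have h1 : interior (convexHull ℝ (S : Set (Pt d))) ⊆
      ⋃ s ∈ voronoiDual S, convexHull ℝ (s : Set (Pt d)) := by
    intro y hy
    obtain ⟨c, hc⟩ := exists_mem_convexHull_nearestSites_of_mem_interior hy
    exact Set.mem_biUnion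
      (mem_voronoiDual_iff.2 ⟨nearestSites_nonempty hne c, c, subset_rfl⟩) hc
  have h2 := closure_minimal h1 hclosed (convexHull_subset_closure_interior hS hx)
  simpa only [Set.mem_iUnion₂, exists_prop] using h2

/-- The straight-line dual of the Voronoi diagram of a generic set, as a triangulation. -/
def delaunayTriangulation (hS : IsGeneric S) : Triangulation S where
  faces := voronoiDual S
  isRelLowerSet_faces := by
    intro s hs
    refine ⟨hs.1, fun r hr hne => ?_⟩
    obtain ⟨-, c, hc⟩ := mem_voronoiDual_iff.1 hs
    exact mem_voronoiDual_iff.2 ⟨hne, c, hr.trans hc⟩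
  indep := by
    intro s hs
    obtain ⟨-, c, hc⟩ := mem_voronoiDual_iff.1 hs
    exact (affineIndependent_nearestSites hS c).mono (Finset.coe_subset.2 hc)
  inter_subset_convexHull := by
    intro s r hs hr
    obtain ⟨-, c₁, h₁⟩ := mem_voronoiDual_iff.1 hs
    obtain ⟨-, c₂, h₂⟩ := mem_voronoiDual_iff.1 hr
    exact convexHull_inter_subset_of_subset_nearestSites hS h₁ h₂
  vertices_eq := by
    ext p
    constructor
    · exact fun h => h.2.1 (Finset.mem_singleton_self p)
    · intro hp
      refine ⟨Finset.singleton_nonempty p, Finset.singleton_subset_iff.2 hp, p, ?_⟩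
      rw [Set.mem_iInter₂]
      intro q hq
      rw [Finset.mem_singleton.1 hq]
      intro y _ _
      rw [dist_self]
      exact dist_nonneg
  space_eq := by
    refine Set.Subset.antisymm (Set.iUnion₂_subset fun s hs =>
      convexHull_mono (Finset.coe_subset.2 hs.2.1)) fun x hx => ?_
    obtain ⟨s, hs, hxs⟩ := exists_mem_voronoiDual_of_mem_convexHull hS.affineSpan_eq_top hx
    exact Set.mem_biUnion hs hxs

theorem isDelaunay_delaunayTriangulation (hS : IsGeneric S) :
    (delaunayTriangulation hS).IsDelaunay := rfl

theorem Triangulation.eq_of_faces_eq {t t' : Triangulation S} (h : t.faces = t'.faces) :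
    t = t' :=
  Triangulation.ext h

/-! ### The Delaunay triangulation is the unique minimizer -/

theorem sum_const_weight {s : Finset (Pt d)} (hs : s.Nonempty) :
    ∑ _p ∈ s, (s.card : ℝ)⁻¹ = 1 := by
  rw [Finset.sum_const, nsmul_eq_mul]
  exact mul_inv_cancel₀ (Nat.cast_ne_zero.2 hs.card_pos.ne')

/-- The barycenter of an affinely independent set lies in the convex hull of a subset only if the
subset is everything. -/
theorem subset_of_sum_smul_mem_convexHull {s r : Finset (Pt d)}
    (hs : AffineIndependent ℝ ((↑) : s → Pt d)) (hne : s.Nonempty)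
    (hmem : ∑ p ∈ s, (s.card : ℝ)⁻¹ • p ∈ convexHull ℝ ((s : Set (Pt d)) ∩ r)) : s ⊆ r := by
  classical
  rw [← Finset.coe_inter] at hmem
  obtain ⟨w, -, hw1, hw2⟩ := Finset.mem_convexHull'.1 hmem
  have h1 := affineIndependent_iff.1 hs Finset.univ
    (fun p => (if (p : Pt d) ∈ s ∩ r then w p else 0) - (s.card : ℝ)⁻¹)
  have h2 : ∑ p ∈ s, (if p ∈ s ∩ r then w p else 0) = 1 := by
    rw [← Finset.sum_filter, ← hw1]
    congr 1
    ext p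
    simp only [Finset.mem_filter, Finset.mem_inter]
    tauto
  have h3 : ∑ p ∈ s, (if p ∈ s ∩ r then w p else 0) • p = ∑ p ∈ s, (s.card : ℝ)⁻¹ • p := by
    rw [← hw2]
    simp only [ite_smul, zero_smul]
    rw [← Finset.sum_filter]
    congr 1
    ext p
    simp only [Finset.mem_filter, Finset.mem_inter]
    tauto
  rw [Finset.sum_coe_sort s fun p => (if p ∈ s ∩ r then w p else 0) - (s.card : ℝ)⁻¹,
    Finset.sum_sub_distrib, h2, sum_const_weight hne, sub_self,
    Finset.sum_coe_sort s fun p => ((if p ∈ s ∩ r then w p else 0) - (s.card : ℝ)⁻¹) • p] at h1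
  simp only [sub_smul, Finset.sum_sub_distrib] at h1
  rw [h3, sub_self] at h1
  intro p hp
  by_contra hpr
  have h4 := h1 trivial rfl ⟨p, hp⟩ (Finset.mem_univ _)
  simp only [Finset.mem_inter, hpr, and_false, if_false, zero_sub, neg_eq_zero, inv_eq_zero,
    Nat.cast_eq_zero] at h4
  exact hne.card_pos.ne' h4

theorem sum_smul_mem_convexHull {s : Finset (Pt d)} (hne : s.Nonempty) :
    ∑ p ∈ s, (s.card : ℝ)⁻¹ • p ∈ convexHull ℝ (s : Set (Pt d)) :=
  Finset.mem_convexHull'.2 ⟨fun _ => (s.card : ℝ)⁻¹, fun _ _ => by positivity,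
    sum_const_weight hne, rfl⟩

theorem sum_smul_mem_interior_convexHull {s : Finset (Pt d)}
    (hs : AffineIndependent ℝ ((↑) : s → Pt d)) (hcard : s.card = d + 1) :
    ∑ p ∈ s, (s.card : ℝ)⁻¹ • p ∈ interior (convexHull ℝ (s : Set (Pt d))) := by
  have hne : s.Nonempty := Finset.card_pos.1 (by omega)
  have h := (simplexBasis hs hcard).centroid_mem_interior_convexHull
  rw [range_simplexBasis] at h
  convert h using 1
  have : Nonempty s := hne.to_subtype
  rw [Finset.centroid, Finset.affineCombination_eq_linear_combination _ _ _
    (Finset.univ.sum_centroidWeights_eq_one_of_nonempty ℝ Finset.univ_nonempty),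
    ← Finset.sum_coe_sort s]
  simp only [Finset.centroidWeights_apply, Finset.card_univ, Fintype.card_coe]
  rfl

namespace Triangulation

/-- Every simplex of a triangulation of a spanning set is a face of a `d`-simplex, since the
`d`-simplices cover the convex hull up to a null set and hence everywhere. -/
theorem exists_cell_of_mem_faces (t : Triangulation S)
    (hS : affineSpan ℝ (S : Set (Pt d)) = ⊤) {s : Finset (Pt d)} (hs : s ∈ t.faces) :
    ∃ r ∈ t.cells, s ⊆ r := by
  set U : Set (Pt d) := ⋃ r ∈ t.cells, convexHull ℝ (r : Set (Pt d))
  have hU : IsClosed U :=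
    t.cells.finite_toSet.isClosed_biUnion fun r _ => (isCompact_convexHull_coe r).isClosed
  have h1 : interior (convexHull ℝ (S : Set (Pt d))) ⊆ U := by
    by_contra hcon
    have h2 : (interior (convexHull ℝ (S : Set (Pt d))) \ U).Nonempty := Set.sdiff_nonempty.2 hcon
    refine ((isOpen_interior.sdiff hU).measure_pos volume h2).ne' (measure_mono_null ?_
      t.volume_diff_cells)
    exact Set.sdiff_subset_sdiff_left interior_subset
  have hne := t.nonempty_of_mem_faces hs
  have hmem := sum_smul_mem_convexHull hne
  have h3 := closure_minimal h1 hU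
    (convexHull_subset_closure_interior hS (t.convexHull_subset_of_mem_faces hs hmem))
  obtain ⟨r, hr, hxr⟩ := Set.mem_iUnion₂.1 h3
  exact ⟨r, hr, subset_of_sum_smul_mem_convexHull (t.indep hs) hne
    (t.inter_subset_convexHull hs ((t.mem_cells r).1 hr).1 ⟨hmem, hxr⟩)⟩

/-- A triangulation of `S` that is contained in another one is equal to it, since both of them
cover the convex hull. -/
theorem eq_of_faces_subset {t t' : Triangulation S} (h : t.faces ⊆ t'.faces) : t = t' := by
  refine eq_of_faces_eq (Set.Subset.antisymm h fun s hs => ?_)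
  have hne := t'.nonempty_of_mem_faces hs
  have hmem := sum_smul_mem_convexHull hne
  have h1 := t'.convexHull_subset_of_mem_faces hs hmem
  rw [← t.space_eq, Geometry.SimplicialComplex.mem_space_iff] at h1
  obtain ⟨r, hr, hxr⟩ := h1
  exact t.down_closed hr (subset_of_sum_smul_mem_convexHull (t'.indep hs) hne
    (t'.inter_subset_convexHull hs (h hr) ⟨hmem, hxr⟩)) hne

theorem exists_mem_liftedSurface (t : Triangulation S) {x : Pt d}
    (hx : x ∈ convexHull ℝ (S : Set (Pt d))) : ∃ z, (x, z) ∈ t.liftedSurface := by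
  rw [← t.space_eq, Geometry.SimplicialComplex.mem_space_iff] at hx
  obtain ⟨s, hs, hxs⟩ := hx
  obtain ⟨z, hz⟩ := exists_mem_convexHull_lift hxs
  exact ⟨z, t.mem_liftedSurface_iff.2 ⟨s, hs, hz⟩⟩

theorem mem_convexHull_of_mem_liftedSurface (t : Triangulation S) {x : Pt d} {z : ℝ}
    (h : (x, z) ∈ t.liftedSurface) : x ∈ convexHull ℝ (S : Set (Pt d)) := by
  obtain ⟨s, hs, hz⟩ := t.mem_liftedSurface_iff.1 h
  exact t.convexHull_subset_of_mem_faces hs (mem_convexHull_of_mem_convexHull_lift hz)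

theorem nonneg_of_mem_liftedSurface (t : Triangulation S) {x : Pt d} {z : ℝ}
    (h : (x, z) ∈ t.liftedSurface) : 0 ≤ z := by
  obtain ⟨s, -, hz⟩ := t.mem_liftedSurface_iff.1 h
  exact nonneg_of_mem_convexHull_lift hz

/-- Over each of its points the lifted Delaunay triangulation is touched from below by a supporting
affine function, which interpolates the paraboloid exactly at a set of nearest sites. -/
theorem IsDelaunay.exists_affineMap {t : Triangulation S} (ht : t.IsDelaunay) {x : Pt d} {z : ℝ}
    (hz : (x, z) ∈ t.liftedSurface) :
    ∃ (c : Pt d) (h : Pt d →ᵃ[ℝ] ℝ), h x = z ∧ (∀ p ∈ S, h p ≤ ‖p‖ ^ 2) ∧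
      ∀ p ∈ S, h p = ‖p‖ ^ 2 ↔ p ∈ nearestSites S c := by
  obtain ⟨s, hs, hz⟩ := t.mem_liftedSurface_iff.1 hz
  have hsS := t.subset_of_mem_faces hs
  rw [ht, mem_voronoiDual_iff] at hs
  obtain ⟨hne, c, hc⟩ := hs
  obtain ⟨h, hle, heq⟩ := exists_supporting_affineMap (hne.mono hsS) c
  exact ⟨c, h, ((mem_convexHull_lift_iff_of_affineMap
    fun p hp => (heq p (hsS hp)).2 (hc hp)).1 hz).2.symm, hle, heq⟩

theorem IsDelaunay.height_le {D : Triangulation S} (hD : D.IsDelaunay) (t : Triangulation S)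
    {x : Pt d} {z z' : ℝ} (hz : (x, z) ∈ D.liftedSurface) (hz' : (x, z') ∈ t.liftedSurface) :
    z ≤ z' := by
  obtain ⟨c, h, rfl, hle, -⟩ := hD.exists_affineMap hz
  obtain ⟨s, hs, hz'⟩ := t.mem_liftedSurface_iff.1 hz'
  exact affineMap_le_of_mem_convexHull_lift (fun p hp => hle p (t.subset_of_mem_faces hs hp)) hz'

theorem IsDelaunay.bodyBelow_subset {D : Triangulation S} (hD : D.IsDelaunay)
    (t : Triangulation S) : D.bodyBelow ⊆ t.bodyBelow := by
  rintro ⟨x, y⟩ ⟨h0, z, hz, hyz⟩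
  obtain ⟨z', hz'⟩ := t.exists_mem_liftedSurface (D.mem_convexHull_of_mem_liftedSurface hz)
  exact ⟨h0, z', hz', hyz.trans (hD.height_le t hz hz')⟩

theorem volume_bodyBelow_le_iff (t t' : Triangulation S) :
    volume t.bodyBelow ≤ volume t'.bodyBelow ↔ t.V ≤ t'.V := by
  have h := t'.V_nonneg
  rw [volume_bodyBelow, volume_bodyBelow, ENNReal.ofReal_le_ofReal_iff (by positivity),
    div_le_div_iff_of_pos_right (by positivity)]

theorem IsDelaunay.V_le {D : Triangulation S} (hD : D.IsDelaunay) (t : Triangulation S) :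
    D.V ≤ t.V :=
  (volume_bodyBelow_le_iff D t).1 (measure_mono (hD.bodyBelow_subset t))

/-- If the lifted surface of `t` is strictly above that of the Delaunay triangulation at the
barycenter of a cell, then the two bodies differ by a nonempty open set, so their volumes differ. -/
theorem IsDelaunay.cell_mem_voronoiDual {D t : Triangulation S} (hD : D.IsDelaunay)
    (hV : t.V ≤ D.V) {s : Finset (Pt d)} (hs : s ∈ t.cells) : s ∈ voronoiDual S := by
  obtain ⟨hsf, hcard⟩ := (t.mem_cells s).1 hs
  have hind := t.indep hsf
  have hne := t.nonempty_of_mem_faces hsf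
  have hsS := t.subset_of_mem_faces hsf
  obtain ⟨L, hL⟩ := exists_affineMap_eq hind hcard fun p => ‖p‖ ^ 2
  set x := ∑ p ∈ s, (s.card : ℝ)⁻¹ • p with hx
  have hxi : x ∈ interior (convexHull ℝ (s : Set (Pt d))) :=
    sum_smul_mem_interior_convexHull hind hcard
  obtain ⟨z, hz⟩ :=
    D.exists_mem_liftedSurface (t.convexHull_subset_of_mem_faces hsf (interior_subset hxi))
  have hLz : L x ≤ z := by
    by_contra! hlt
    have hz0 := D.nonneg_of_mem_liftedSurface hz
    let O : Set (Pt d × ℝ) :=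
      {w | w.1 ∈ interior (convexHull ℝ (s : Set (Pt d))) ∧ 0 < w.2 ∧ w.2 < L w.1} \ D.bodyBelow
    have hO : IsOpen O := by
      refine IsOpen.sdiff ?_ D.isCompact_bodyBelow.isClosed
      have hLc : Continuous L := L.continuous_of_finiteDimensional
      exact (isOpen_interior.preimage continuous_fst).inter
        ((isOpen_lt continuous_const continuous_snd).inter
          (isOpen_lt continuous_snd (hLc.comp continuous_fst)))
    have hOne : O.Nonempty := by
      refine ⟨(x, (z + L x) / 2), ⟨hxi, ?_, ?_⟩, ?_⟩
      · change 0 < (z + L x) / 2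
        linarith
      · change (z + L x) / 2 < L x
        linarith
      · rintro ⟨-, z', hz', hle⟩
        have h1 := hD.height_le D hz' hz
        simp only at hle
        linarith
    have hsub : O ⊆ t.bodyBelow \ D.bodyBelow := by
      rintro w ⟨⟨h1, h2, h3⟩, h4⟩
      refine ⟨⟨h2.le, L w.1, t.mem_liftedSurface_iff.2 ⟨s, hsf, ?_⟩, h3.le⟩, h4⟩
      exact (mem_convexHull_lift_iff_of_affineMap hL).2 ⟨interior_subset h1, rfl⟩
    refine (hO.measure_pos volume hOne).ne' (measure_mono_null hsub ?_)
    rw [measure_sdiff (hD.bodyBelow_subset t)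
      D.isCompact_bodyBelow.measurableSet.nullMeasurableSet
      D.isCompact_bodyBelow.measure_lt_top.ne]
    exact tsub_eq_zero_of_le ((volume_bodyBelow_le_iff t D).2 hV)
  obtain ⟨c, h, rfl, hle, heq⟩ := hD.exists_affineMap hz
  refine mem_voronoiDual_iff.2 ⟨hne, c, fun p hp => (heq p (hsS hp)).1 ?_⟩
  refine affineMap_eq_of_weight_pos (fun q hq => hle q (hsS hq)) (w := fun _ => (s.card : ℝ)⁻¹)
    (fun _ _ => by positivity) (sum_const_weight hne) ?_ hp
    (inv_pos.2 (Nat.cast_pos.2 hne.card_pos))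
  refine le_trans (le_of_eq ?_) hLz
  rw [hx, affineMap_sum_smul L (sum_const_weight hne)]
  exact Finset.sum_congr rfl fun q hq => by rw [hL q hq]

theorem IsDelaunay.eq_of_V_le {D t : Triangulation S} (hD : D.IsDelaunay)
    (hS : affineSpan ℝ (S : Set (Pt d)) = ⊤) (hV : t.V ≤ D.V) : t = D := by
  refine eq_of_faces_subset fun s hs => ?_
  obtain ⟨r, hr, hsr⟩ := t.exists_cell_of_mem_faces hS hs
  have h1 := hD.cell_mem_voronoiDual hV hr
  rw [← hD] at h1
  exact D.down_closed h1 hsr (t.nonempty_of_mem_faces hs)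

end Triangulation

end Delaunay
end

theorem theorem2 (d : ℕ) (S : Finset (Delaunay.Pt d)) :
    (∀ t : Delaunay.Triangulation S,
      ((d : ℝ) + 1) ^ 2 * t.C2 + t.V =
        ((d : ℝ) + 1) * ((d : ℝ) + 2) *
          ∫ x in convexHull ℝ (S : Set (Delaunay.Pt d)), ‖x‖ ^ 2) ∧
    (∀ t : Delaunay.Triangulation S,
      volume t.bodyBelow = ENNReal.ofReal (t.V / ((d : ℝ) + 1))) ∧
    (Delaunay.IsGeneric S →
      (∃! t : Delaunay.Triangulation S, t.IsDelaunay) ∧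
      ∀ t : Delaunay.Triangulation S,
        (∀ t' : Delaunay.Triangulation S, t.V ≤ t'.V) ↔ t.IsDelaunay) := by
  refine ⟨fun t => t.C2_add_V, fun t => t.volume_bodyBelow, fun hS => ?_⟩
  have hD := Delaunay.isDelaunay_delaunayTriangulation hS
  refine ⟨⟨_, hD, fun t ht => Delaunay.Triangulation.eq_of_faces_eq (ht.trans hD.symm)⟩,
    fun t => ⟨fun h => ?_, fun ht t' => ht.V_le t'⟩⟩
  exact hD.eq_of_V_le hS.affineSpan_eq_top (h _) ▸ hD
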